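/- Let $X_1,X_2,\dots$ be i.i.d. standard exponential random variables, $S_i=X_1+\dots+X_i$ and $Y_k=\frac{2}{k(k+1)}\sum_{i=1}^k S_i$. For $t\ge 0$ and $n\ge 1$ put $$G_n(t)=\mathbb P\Bigl\{\min_{1\le k\le n}Y_k\ge t\Bigr\},\qquad G(t)=\mathbb P\Bigl\{\inf_{k\ge 1}Y_k\ge t\Bigr\}.$$ Let $l_j=\frac{j(j+1)}2$. For $k\ge 1$ let $L_k$ be the $k\times k$ matrix whose $j$-th column has the entries $l_j,-2l_j,l_j$ in the rows $j,j+1,j+2$ (as far as these rows exist) and zeros elsewhere; it is the inverse of the matrix $A_k$ determined by $(Y_1,\dots,Y_k)^\top=A_k(X_1,\dots,X_k)^\top$. Let $M_k$ be the $k\times(k-1)$ matrix obtained from $L_k$ by deleting the last column, let $$P_k=\{\mathbf y\in\mathbb R^{k-1}: M_k\mathbf y\ge-\mathbf 1,\ \mathbf y\ge\mathbf 0\}$$ (inequalities coordinatewise; $P_1$ is the one-point space $\mathbb R^0$, of volume $1$), and let $$c_k=2^{-k}\,k!\,(k+1)!\,\mathrm{vol}_{k-1}(P_k),\qquad k\ge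 1 .$$ Then the $c_k$ are positive and finite, $c_k=O(\sqrt k\,e^k)$ as $k\to\infty$, and the following hold, where derivatives at $t=0$ are right derivatives. 1. Every $G_n$, $n\ge1$, is continuously differentiable on $[0,\infty)$. 2. The series $\sum_{k\ge1}c_k(te^{-t})^{k-1}$ converges for every $t\in[0,1)$, and for every $\varepsilon\in(0,1)$ the derivatives $G_n'(t)$ converge, as $n\to\infty$, to $-G(t)e^{-t}\sum_{k=1}^\infty c_k(te^{-t})^{k-1}$ uniformly on $[0,1-\varepsilon]$. 3. $G$ is continuously differentiable on $[0,1)$, and $$G'(t)=-G(t)e^{-t}\sum_{k=1}^\infty c_k\bigl(te^{-t}\bigr)^{k-1},\qquad t\in[0,1).$$ -/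

import Mathlib

open MeasureTheory ProbabilityTheory Filter Asymptotics
open scoped Matrix Nat

namespace ExpArea

noncomputable section

/-- The random walk `S_k = X_1 + ... + X_k`; the increment `X_{i+1}` is `X i`. -/
def S {Ω : Type*} (X : ℕ → Ω → ℝ) (k : ℕ) (ω : Ω) : ℝ :=
  ∑ i ∈ Finset.range k, X i ω

/-- The normalized `k`-step area `Y_k = 2 / (k (k + 1)) * (S_1 + ... + S_k)`, for `k ≥ 1`. -/
def Y {Ω : Type*} (X : ℕ → Ω → ℝ) (k : ℕ) (ω : Ω) : ℝ :=
  2 / ((k : ℝ) * (k + 1)) * ∑ i ∈ Finset.Icc 1 k, S X i ω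

/-- `G_n(t) = P {min_{1 ≤ k ≤ n} Y_k ≥ t}`. -/
def Gn {Ω : Type*} [MeasurableSpace Ω] (P : Measure Ω) (X : ℕ → Ω → ℝ) (n : ℕ) (t : ℝ) : ℝ :=
  P.real {ω | (t : EReal) ≤ ⨅ k ∈ Finset.Icc 1 n, (Y X k ω : EReal)}

/-- `G(t) = P {inf_{k ≥ 1} Y_k ≥ t}`; the infimum is taken in the extended reals. -/
def G {Ω : Type*} [MeasurableSpace Ω] (P : Measure Ω) (X : ℕ → Ω → ℝ) (t : ℝ) : ℝ :=
  P.real {ω | (t : EReal) ≤ ⨅ k ∈ Set.Ici 1, (Y X k ω : EReal)}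

/-- The triangular numbers `l_k = k (k + 1) / 2`. -/
def l (k : ℕ) : ℝ := (k : ℝ) * (k + 1) / 2

/-- The matrix `A_n` with `(Y_1, ..., Y_n) = A_n (X_1, ..., X_n)`; indices start at `0`. -/
def A (n : ℕ) : Matrix (Fin n) (Fin n) ℝ := Matrix.of fun i j =>
  if (j : ℕ) ≤ i then 2 * ((i : ℝ) + 1 - j) / (((i : ℝ) + 1) * (i + 2)) else 0

/-- The inverse `L_n` of `A_n` (see `L_mul_A`), written out: its `j`th column is
`l_j, -2 l_j, l_j` in the rows `j, j + 1, j + 2` (counted from `1`), and `0` elsewhere. -/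
def L (n : ℕ) : Matrix (Fin n) (Fin n) ℝ := Matrix.of fun i j =>
  if (i : ℕ) = j then l (j + 1)
  else if (i : ℕ) = j + 1 then -2 * l (j + 1)
  else if (i : ℕ) = j + 2 then l (j + 1)
  else 0

/-- The polytope `P_{k+1}` in `ℝ^k`: all `y ≥ 0` such that `M y ≥ -1`, where `M` is the
`(k + 1) × k` matrix obtained from `L_{k+1}` by deleting its last column. -/
def polytope (k : ℕ) : Set (Fin k → ℝ) :=
  {y | -1 ≤ (L (k + 1)).submatrix id Fin.castSucc *ᵥ y ∧ 0 ≤ y}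

/-- `c_k = 2^{-k} k! (k + 1)! vol(P_k)` for `k ≥ 1` (the value at `0` is not used). -/
def c : ℕ → ℝ
  | 0 => 0
  | k + 1 => (k + 1)! * (k + 2)! / 2 ^ (k + 1) * volume.real (polytope k)

/-- `-G(t) e^{-t} ∑_{k ≥ 1} c_k (t e^{-t})^{k-1}`. -/
def rhs {Ω : Type*} [MeasurableSpace Ω] (P : Measure Ω) (X : ℕ → Ω → ℝ) (t : ℝ) : ℝ :=
  -G P X t * Real.exp (-t) * ∑' k : ℕ, c (k + 1) * (t * Real.exp (-t)) ^ k

theorem l_mul_A {n : ℕ} (i j : Fin n) :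
    l (i + 1) * A n i j = if (j : ℕ) ≤ i then (i : ℝ) + 1 - j else 0 := by
  simp only [A, l, Matrix.of_apply]
  split_ifs
  · push_cast; field_simp; ring
  · simp

theorem L_mul_A (n : ℕ) : L n * A n = 1 := by
  ext i j
  rw [Matrix.mul_apply]
  have key : ∀ m : Fin n, L n i m * A n m j =
      (if (m : ℕ) = i then (if (j : ℕ) ≤ m then (m : ℝ) + 1 - j else 0) else 0)
      + (if (m : ℕ) + 1 = i then -2 * (if (j : ℕ) ≤ m then (m : ℝ) + 1 - j else 0) else 0)
      + (if (m : ℕ) + 2 = i then (if (j : ℕ) ≤ m then (m : ℝ) + 1 - j else 0) else 0) := by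
    intro m
    rw [← l_mul_A m j]
    simp only [L, Matrix.of_apply]
    split_ifs <;> first | omega | ring
  rw [Finset.sum_congr rfl fun m _ => key m]
  obtain ⟨i, hi⟩ := i
  obtain ⟨j, hj⟩ := j
  rw [Fin.sum_univ_eq_sum_range (fun m : ℕ =>
      (if m = i then (if j ≤ m then (m : ℝ) + 1 - j else 0) else 0)
      + (if m + 1 = i then -2 * (if j ≤ m then (m : ℝ) + 1 - j else 0) else 0)
      + (if m + 2 = i then (if j ≤ m then (m : ℝ) + 1 - j else 0) else 0)) n,
    Matrix.one_apply, Finset.sum_add_distrib, Finset.sum_add_distrib]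
  simp only [Fin.mk.injEq]
  rcases i with _ | _ | i
  · simp [Finset.sum_ite_eq', show 0 < n by omega]
    by_cases h : j = 0
    · simp [h]
    · simp [h, Ne.symm h]
  · simp [Finset.sum_ite_eq', show 0 < n by omega, show 1 < n by omega]
    rcases j with _ | _ | j <;> simp
    norm_num
  · simp only [Nat.add_right_cancel_iff, show ∀ m : ℕ, (m + 1 = i + 1 + 1) = (m = i + 1) by
      intro m; simp]
    simp only [Finset.sum_ite_eq', Finset.mem_range, show i < n by omega,
      show i + 1 < n by omega, show i + 1 + 1 < n by omega, if_true]
    push_cast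
    rcases lt_trichotomy j (i + 1) with h | h | h
    · rw [if_pos (by omega), if_pos (by omega), if_pos (by omega), if_neg (by omega)]; ring
    · subst h
      rw [if_pos (by omega), if_pos (by omega), if_neg (by omega), if_neg (by omega)]
      push_cast; ring
    · rw [if_neg (show ¬ j ≤ i + 1 by omega), if_neg (show ¬ j ≤ i by omega)]
      rcases Nat.lt_or_ge (i + 2) j with h' | h'
      · rw [if_neg (by omega), if_neg (by omega)]; ring
      · obtain rfl : j = i + 2 := by omega
        simp; ring

theorem L_eq_inv (n : ℕ) : L n = (A n)⁻¹ :=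
  (Matrix.inv_eq_left_inv (L_mul_A n)).symm

theorem c_one : c 1 = 1 := by
  have h : polytope 0 = Set.univ := by
    ext y
    simp only [polytope, Set.mem_ofPred_eq, Set.mem_univ, iff_true]
    refine ⟨fun i => ?_, fun i => i.elim0⟩
    simp [Matrix.mulVec, dotProduct]
  have hv : volume.real (Set.univ : Set (Fin 0 → ℝ)) = 1 := by
    rw [Measure.real, Measure.volume_pi_eq_dirac]
    simp
  simp [c, h, hv]

end

end ExpArea

/-!
Let `k` be the place where `Y_1, ..., Y_n` attains its minimum and `s` the value of this minimum.
Given `Y_k = s`, the increments `X_1, ..., X_k` are nonnegative and `Y_j ≥ s` for all `j < k`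
exactly when the numbers `Y_j / s - 1` form a point of the polytope `P_k`, which by scaling produces
the factor `s ^ (k - 1)` and the volume of `P_k`. At the minimum `S_k ≤ k s`, and by lack of memory
`X_{k + 1} - (k s - S_k)`, given that it is positive, and the increments after it drive a fresh walk
of `n - k` steps; the probability `exp (-(k s - S_k))` of that condition cancels the dependence of
the density on `S_k`. So `-G_n'` is a convolution sum of `c_k s ^ (k - 1) exp (-k s)` and `G_{n-k}`,
up to the term `k = n`. On `[0, b]` with `b < 1` a Chernoff bound for `Y_n` makes that last term
vanish and gives `G_n → G` uniformly, and dominated convergence identifies the limit of `G_n'`;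
integrating, one differentiates `G`.
-/

namespace ExpArea

noncomputable section

open scoped ENNReal Topology

/-! ### Second differences and double partial sums -/

/-- The matrix of second differences; it inverts the formation of double partial sums. -/
def secondDiff (n : ℕ) : Matrix (Fin n) (Fin n) ℝ := Matrix.of fun i j =>
  if (i : ℕ) = j then 1
  else if (i : ℕ) = j + 1 then -2
  else if (i : ℕ) = j + 2 then 1
  else 0

/-- The area `∑_{i < j} (j - i) x_i` swept in `j` steps by a walk with the increments `x`. The
truncated subtraction discards the increments after the `j`th. -/
def area {n : ℕ} (x : Fin n → ℝ) (j : ℕ) : ℝ := ∑ i : Fin n, ((j - (i : ℕ) : ℕ) : ℝ) * x i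

theorem l_pos (k : ℕ) : 0 < l (k + 1) := by
  unfold l; positivity

theorem l_add (k j : ℕ) : l (k + j) = l k + j * k + l j := by
  simp only [l]; push_cast; ring

theorem l_succ (k : ℕ) : l (k + 1) = l k + (k + 1) := by
  simp only [l]; push_cast; ring

theorem prod_l (k : ℕ) : ∏ j ∈ Finset.range k, l (j + 1) = k ! * (k + 1)! / 2 ^ k := by
  induction k with
  | zero => simp
  | succ k ih =>
    rw [Finset.prod_range_succ, ih, l, Nat.factorial_succ (k + 1), Nat.factorial_succ k]
    push_cast; field_simp; ring

theorem area_zero {n : ℕ} (x : Fin n → ℝ) : area x 0 = 0 := by simp [area]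

theorem area_add {n : ℕ} (x y : Fin n → ℝ) (j : ℕ) : area (x + y) j = area x j + area y j := by
  simp [area, mul_add, Finset.sum_add_distrib]

theorem area_smul {n : ℕ} (r : ℝ) (x : Fin n → ℝ) (j : ℕ) : area (r • x) j = r * area x j := by
  simp only [area, Finset.mul_sum, Pi.smul_apply, smul_eq_mul]
  exact Finset.sum_congr rfl fun i _ => by ring

theorem area_nonneg {n : ℕ} {x : Fin n → ℝ} (hx : 0 ≤ x) (j : ℕ) : 0 ≤ area x j :=
  Finset.sum_nonneg fun i _ => mul_nonneg (Nat.cast_nonneg _) (hx i)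

theorem continuous_area {n : ℕ} (j : ℕ) : Continuous fun x : Fin n → ℝ => area x j := by
  unfold area; fun_prop

theorem area_succ {n : ℕ} (x : Fin n → ℝ) (j : ℕ) :
    area x (j + 1) = area x j + ∑ i : Fin n, if (i : ℕ) < j + 1 then x i else 0 := by
  rw [area, area, ← Finset.sum_add_distrib]
  refine Finset.sum_congr rfl fun i _ => ?_
  split_ifs with hi
  · rw [Nat.sub_add_comm (Nat.lt_succ_iff.1 hi)]; push_cast; ring
  · rw [Nat.sub_eq_zero_of_le (by omega), Nat.sub_eq_zero_of_le (by omega)]; simp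

theorem area_add_eq {n : ℕ} (x : Fin n → ℝ) (j : ℕ) : area x (n + j) = area x n + j * ∑ i, x i := by
  rw [area, area, Finset.mul_sum, ← Finset.sum_add_distrib]
  refine Finset.sum_congr rfl fun i _ => ?_
  rw [Nat.sub_add_comm i.isLt.le]; push_cast; ring

theorem sum_eq_area_sub {n : ℕ} (x : Fin (n + 1) → ℝ) :
    ∑ i, x i = area x (n + 1) - area x n := by
  rw [area_succ, add_sub_cancel_left]
  exact Finset.sum_congr rfl fun i _ => (if_pos i.isLt).symm

theorem area_eq_sum_partialSums {n j : ℕ} (f : ℕ → ℝ) (h : j ≤ n) :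
    area (fun i : Fin n => f i) j = ∑ k ∈ Finset.Icc 1 j, ∑ i ∈ Finset.range k, f i := by
  induction j with
  | zero => simp [area_zero]
  | succ j ih =>
    rw [area_succ, ih (by omega), Finset.sum_Icc_succ_top (by omega),
      Fin.sum_univ_eq_sum_range (fun i => if i < j + 1 then f i else 0) n, ← Finset.sum_filter]
    congr 2
    ext i
    simp only [Finset.mem_filter, Finset.mem_range]
    omega

theorem area_one {n j : ℕ} (h : j ≤ n) : area (1 : Fin n → ℝ) j = l j := by
  refine (area_eq_sum_partialSums (fun _ => 1) h).trans ?_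
  induction j with
  | zero => simp [l]
  | succ j ih => rw [Finset.sum_Icc_succ_top (by omega), ih (by omega), l_succ]; simp

theorem area_single {n : ℕ} (j : ℕ) : area (Pi.single 0 1 : Fin (n + 1) → ℝ) j = j := by
  simp [area, Pi.single_apply]

theorem L_eq_secondDiff_mul (n : ℕ) :
    L n = secondDiff n * Matrix.diagonal fun j : Fin n => l (j + 1) := by
  ext i j
  rw [Matrix.mul_diagonal]
  simp only [L, secondDiff, Matrix.of_apply]
  split_ifs <;> ring

/-- The matrix sending the increments of a walk to its areas. -/
def areaMatrix (n : ℕ) : Matrix (Fin n) (Fin n) ℝ :=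
  Matrix.of fun i j => (((i : ℕ) + 1 - (j : ℕ) : ℕ) : ℝ)

theorem areaMatrix_mulVec {n : ℕ} (x : Fin n → ℝ) :
    areaMatrix n *ᵥ x = fun j : Fin n => area x (j + 1) := rfl

theorem areaMatrix_eq_mul_A (n : ℕ) :
    areaMatrix n = (Matrix.diagonal fun j : Fin n => l (j + 1)) * A n := by
  ext i j
  rw [Matrix.diagonal_mul, l_mul_A, areaMatrix, Matrix.of_apply]
  split_ifs with h
  · rw [Nat.cast_sub (by omega)]; push_cast; ring
  · rw [Nat.sub_eq_zero_of_le (by omega), Nat.cast_zero]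

theorem secondDiff_mul_areaMatrix (n : ℕ) : secondDiff n * areaMatrix n = 1 := by
  rw [areaMatrix_eq_mul_A, ← Matrix.mul_assoc, ← L_eq_secondDiff_mul, L_mul_A]

theorem secondDiff_mulVec_area {n : ℕ} (x : Fin n → ℝ) :
    secondDiff n *ᵥ (fun j : Fin n => area x (j + 1)) = x := by
  rw [← areaMatrix_mulVec, Matrix.mulVec_mulVec, secondDiff_mul_areaMatrix, Matrix.one_mulVec]

theorem area_secondDiff_mulVec {n : ℕ} (T : Fin n → ℝ) (j : Fin n) :
    area (secondDiff n *ᵥ T) (j + 1) = T j := by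
  refine congrFun (areaMatrix_mulVec (secondDiff n *ᵥ T)).symm j |>.trans ?_
  rw [Matrix.mulVec_mulVec, mul_eq_one_comm.1 (secondDiff_mul_areaMatrix n), Matrix.one_mulVec]

theorem det_secondDiff (n : ℕ) : (secondDiff n).det = 1 := by
  rw [Matrix.det_of_isLowerTriangular]
  · simp [secondDiff]
  · intro i j hij
    have : (i : ℕ) < j := hij
    simp only [secondDiff, Matrix.of_apply]
    rw [if_neg (by omega), if_neg (by omega), if_neg (by omega)]

theorem secondDiff_mulVec_l (n : ℕ) : secondDiff n *ᵥ (fun j : Fin n => l (j + 1)) = 1 := by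
  conv_rhs => rw [← secondDiff_mulVec_area (1 : Fin n → ℝ)]
  congr! 2 with j
  exact (area_one j.isLt).symm

theorem secondDiff_mulVec_succ (n : ℕ) :
    secondDiff (n + 1) *ᵥ (fun j : Fin (n + 1) => (j : ℝ) + 1) = Pi.single 0 1 := by
  simpa [area_single] using secondDiff_mulVec_area (Pi.single 0 1 : Fin (n + 1) → ℝ)

/-- The increments of the walk whose areas are the entries of `u` followed by a final `0`. -/
def bridge {p : ℕ} (u : Fin p → ℝ) : Fin (p + 1) → ℝ :=
  secondDiff (p + 1) *ᵥ (Fin.snoc u 0 : Fin (p + 1) → ℝ)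

theorem continuous_bridge (p : ℕ) : Continuous (bridge : (Fin p → ℝ) → _) :=
  continuous_const.matrix_mulVec
    (Continuous.finSnoc (A := fun _ => ℝ) continuous_id (continuous_const (y := (0 : ℝ))))

theorem area_bridge {p : ℕ} (u : Fin p → ℝ) (j : Fin p) : area (bridge u) (j + 1) = u j := by
  simpa [bridge] using area_secondDiff_mulVec (Fin.snoc u 0 : Fin (p + 1) → ℝ) j.castSucc

theorem area_bridge_last {p : ℕ} (u : Fin p → ℝ) : area (bridge u) (p + 1) = 0 := by
  simpa [bridge] using area_secondDiff_mulVec (Fin.snoc u 0 : Fin (p + 1) → ℝ) (Fin.last p)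

theorem bridge_smul {p : ℕ} (r : ℝ) (u : Fin p → ℝ) : bridge (r • u) = r • bridge u := by
  rw [bridge, bridge, ← Matrix.mulVec_smul]
  congr 1
  ext i; refine Fin.lastCases ?_ (fun i => ?_) i <;> simp

/-- The last entry of `u`, or `0` if there is none. -/
def lastEntry {p : ℕ} (u : Fin p → ℝ) : ℝ := area (bridge u) p

theorem sum_bridge {p : ℕ} (u : Fin p → ℝ) : ∑ i, bridge u i = -lastEntry u := by
  rw [sum_eq_area_sub, area_bridge_last, lastEntry, zero_sub]

theorem lastEntry_nonneg {p : ℕ} {u : Fin p → ℝ} (hu : 0 ≤ u) : 0 ≤ lastEntry u := by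
  rcases p with _ | p
  · simp [lastEntry, area_zero]
  · exact (hu _).trans_eq (area_bridge u (Fin.last p)).symm

theorem lastEntry_smul {p : ℕ} (r : ℝ) (u : Fin p → ℝ) :
    lastEntry (r • u) = r * lastEntry u := by
  rw [lastEntry, bridge_smul, area_smul, lastEntry]

theorem continuous_lastEntry (p : ℕ) : Continuous (lastEntry : (Fin p → ℝ) → ℝ) :=
  (continuous_area p).comp (continuous_bridge p)

/-! ### Slicing Lebesgue measure -/

theorem lintegral_comp_smul_of_pos {F : Type*} [NormedAddCommGroup F] [NormedSpace ℝ F]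
    [MeasurableSpace F] [BorelSpace F] [FiniteDimensional ℝ F] (μ : Measure F)
    [μ.IsAddHaarMeasure] (f : F → ℝ≥0∞) {r : ℝ} (hr : 0 < r) :
    ENNReal.ofReal (r ^ Module.finrank ℝ F) * ∫⁻ x, f (r • x) ∂μ = ∫⁻ x, f x ∂μ := by
  have hmap : ∫⁻ x, f (r • x) ∂μ = ∫⁻ x, f x ∂(μ.map (r • ·)) :=
    (lintegral_map_equiv f (Homeomorph.smulOfNeZero r hr.ne').toMeasurableEquiv).symm
  have hpow : 0 < r ^ Module.finrank ℝ F := by positivity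
  rw [hmap, Measure.map_addHaar_smul μ hr.ne', lintegral_smul_measure, smul_eq_mul, ← mul_assoc,
    ← ENNReal.ofReal_mul hpow.le, abs_of_pos (inv_pos.2 hpow), mul_inv_cancel₀ hpow.ne',
    ENNReal.ofReal_one, one_mul]

theorem lintegral_secondDiff_mulVec {n : ℕ} {H : (Fin n → ℝ) → ℝ≥0∞} (hH : Measurable H) :
    ∫⁻ T, H (secondDiff n *ᵥ T) = ∫⁻ x, H x := by
  have hmap := Real.map_matrix_volume_pi_eq_smul_volume_pi (M := secondDiff n)
    (by rw [det_secondDiff]; exact one_ne_zero)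
  rw [det_secondDiff, inv_one, abs_one, ENNReal.ofReal_one, one_smul] at hmap
  conv_rhs => rw [← hmap]
  rw [lintegral_map hH (LinearMap.continuous_on_pi _).measurable]
  simp only [Matrix.toLin'_apply]

theorem lintegral_pi_snoc {α : Type*} [MeasurableSpace α] (μ : Measure α) [SigmaFinite μ] {p : ℕ}
    {H : (Fin (p + 1) → α) → ℝ≥0∞} (hH : Measurable H) :
    ∫⁻ x, H x ∂Measure.pi (fun _ => μ) =
      ∫⁻ τ, ∫⁻ u : Fin p → α, H (Fin.snoc u τ) ∂Measure.pi (fun _ => μ) ∂μ := by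
  have h := (measurePreserving_piFinSuccAbove (fun _ : Fin (p + 1) => μ) (Fin.last p)).symm
  rw [← h.lintegral_comp hH]
  refine (lintegral_prod _ (hH.comp h.measurable).aemeasurable).trans ?_
  refine lintegral_congr fun τ => lintegral_congr fun u => congrArg H ?_
  simp [MeasurableEquiv.piFinSuccAbove, Fin.insertNthEquiv]

/-- Lebesgue measure in the coordinates `(u, θ)` for which the walk has the areas
`u + θ w` at the times `1, …, p` and `θ w_{p + 1}` at the time `p + 1`. -/
theorem lintegral_slices {p : ℕ} {H : (Fin (p + 1) → ℝ) → ℝ≥0∞} (hH : Measurable H)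
    (w : Fin (p + 1) → ℝ) (hw : 0 < w (Fin.last p)) :
    ∫⁻ x, H x = ENNReal.ofReal (w (Fin.last p)) *
      ∫⁻ θ : ℝ, ∫⁻ u : Fin p → ℝ, H (bridge u + θ • (secondDiff (p + 1) *ᵥ w)) := by
  have hdiff : Measurable fun T : Fin (p + 1) → ℝ => H (secondDiff (p + 1) *ᵥ T) :=
    hH.comp (continuous_const.matrix_mulVec continuous_id).measurable
  rw [← lintegral_secondDiff_mulVec hH, volume_pi, lintegral_pi_snoc _ hdiff, ← volume_pi,
    ← lintegral_comp_smul_of_pos volume _ hw, Module.finrank_self, pow_one]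
  congr 1
  refine lintegral_congr fun θ => ?_
  rw [← lintegral_add_right_eq_self _ (θ • fun i : Fin p => w i.castSucc)]
  refine lintegral_congr fun u => ?_
  rw [bridge, ← Matrix.mulVec_smul, ← Matrix.mulVec_add]
  congr 2
  ext i
  refine Fin.lastCases ?_ (fun i => ?_) i
  · simp [mul_comm]
  · simp

theorem lintegral_slices_l {p : ℕ} {H : (Fin (p + 1) → ℝ) → ℝ≥0∞} (hH : Measurable H) :
    ∫⁻ x, H x = ENNReal.ofReal (l (p + 1)) *
      ∫⁻ s : ℝ, ∫⁻ u : Fin p → ℝ, H (bridge u + s • 1) := by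
  rw [lintegral_slices hH (fun j => l (j + 1)) (l_pos p), secondDiff_mulVec_l, Fin.val_last]

theorem lintegral_slices_single {p : ℕ} {H : (Fin (p + 1) → ℝ) → ℝ≥0∞} (hH : Measurable H) :
    ∫⁻ x, H x = ENNReal.ofReal (p + 1) *
      ∫⁻ θ : ℝ, ∫⁻ u : Fin p → ℝ, H (bridge u + θ • Pi.single 0 1) := by
  rw [lintegral_slices hH (fun j => (j : ℝ) + 1) (by positivity), secondDiff_mulVec_succ,
    Fin.val_last]

/-! ### The polytope in area coordinates -/

/-- The polytope `P_{p+1}` in the coordinates `u_j = l_j y_j`: the nonnegative areas of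
the bridges with increments at least `-1`. -/
def bridgeSet (p : ℕ) : Set (Fin p → ℝ) := {u | 0 ≤ u ∧ -1 ≤ bridge u}

theorem measurableSet_bridgeSet (p : ℕ) : MeasurableSet (bridgeSet p) :=
  ((isClosed_le continuous_const continuous_id).inter
    (isClosed_le continuous_const (continuous_bridge p))).measurableSet

theorem smul_mem_slice_iff {p : ℕ} {s : ℝ} (hs : 0 < s) (z : Fin p → ℝ) :
    (0 ≤ s • z ∧ 0 ≤ bridge (s • z) + s • 1) ↔ z ∈ bridgeSet p := by
  have hsmul {n : ℕ} (v : Fin n → ℝ) : 0 ≤ s • v ↔ 0 ≤ v := by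
    simpa only [smul_zero] using smul_le_smul_iff_of_pos_left (b₁ := 0) (b₂ := v) hs
  rw [bridgeSet, Set.mem_ofPred_eq, hsmul, bridge_smul, ← smul_add, hsmul, neg_le_iff_add_nonneg]

theorem L_submatrix_mulVec {p : ℕ} (y : Fin p → ℝ) :
    (L (p + 1)).submatrix id Fin.castSucc *ᵥ y = bridge fun j : Fin p => l (j + 1) * y j := by
  ext i
  simp only [bridge, Matrix.mulVec, dotProduct, Fin.sum_univ_castSucc, Fin.snoc_castSucc,
    Fin.snoc_last, mul_zero, add_zero, Matrix.submatrix_apply, id]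
  refine Finset.sum_congr rfl fun j _ => ?_
  rw [L_eq_secondDiff_mul, Matrix.mul_diagonal, Fin.val_castSucc, mul_assoc]

theorem polytope_eq_preimage (p : ℕ) :
    polytope p = Matrix.toLin' (Matrix.diagonal fun j : Fin p => l (j + 1)) ⁻¹' bridgeSet p := by
  ext y
  have hdiag : Matrix.toLin' (Matrix.diagonal fun j : Fin p => l (j + 1)) y =
      fun j : Fin p => l (j + 1) * y j := by
    ext j; rw [Matrix.toLin'_apply, Matrix.mulVec_diagonal]
  have hpos : 0 ≤ y ↔ 0 ≤ fun j : Fin p => l (j + 1) * y j :=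
    forall_congr' fun j => (mul_nonneg_iff_of_pos_left (l_pos _)).symm
  rw [Set.mem_preimage, hdiag, polytope, bridgeSet, Set.mem_ofPred_eq, Set.mem_ofPred_eq,
    L_submatrix_mulVec, hpos, and_comm]

theorem c_succ (p : ℕ) : c (p + 1) = l (p + 1) * volume.real (bridgeSet p) := by
  have hpos : 0 < ∏ j ∈ Finset.range p, l (j + 1) := Finset.prod_pos fun j _ => l_pos j
  have hdet : LinearMap.det (Matrix.toLin' (Matrix.diagonal fun j : Fin p => l (j + 1))) =
      ∏ j ∈ Finset.range p, l (j + 1) := by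
    rw [LinearMap.det_toLin', Matrix.det_diagonal,
      Fin.prod_univ_eq_prod_range (fun j => l (j + 1)) p]
  rw [c, ← prod_l, Finset.prod_range_succ, polytope_eq_preimage, Measure.real,
    Measure.addHaar_preimage_linearMap _ (by rw [hdet]; exact hpos.ne'), hdet,
    abs_of_pos (inv_pos.2 hpos), ENNReal.toReal_mul, ENNReal.toReal_ofReal (inv_pos.2 hpos).le,
    Measure.real]
  field_simp

theorem lastEntry_le {p : ℕ} {u : Fin p → ℝ} (hu : u ∈ bridgeSet p) : lastEntry u ≤ p + 1 := by
  have h : ∑ i : Fin (p + 1), (-1 : ℝ) ≤ ∑ i, bridge u i := Finset.sum_le_sum fun i _ => hu.2 i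
  rw [sum_bridge, Finset.sum_const, Finset.card_fin, nsmul_eq_mul, mul_neg_one, neg_le_neg_iff] at h
  exact_mod_cast h

theorem neg_one_le_secondDiff_mulVec {n : ℕ} {T : Fin n → ℝ} (h0 : 0 ≤ T)
    (h1 : ∀ j, T j ≤ 1 / 2) : -1 ≤ secondDiff n *ᵥ T := by
  intro i
  have hentry : ∀ j : Fin n, (if (j : ℕ) + 1 = i then -1 else 0 : ℝ) ≤ secondDiff n i j * T j := by
    intro j
    have := h0 j
    have := h1 j
    simp only [secondDiff, Matrix.of_apply, Pi.zero_apply] at *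
    split_ifs <;> first | omega | linarith
  have hcard : ((Finset.univ.filter fun j : Fin n => (j : ℕ) + 1 = i).card : ℝ) ≤ 1 := by
    exact_mod_cast Finset.card_le_one.2 fun a ha b hb => Fin.ext (by simp at ha hb; omega)
  refine le_trans ?_ (Finset.sum_le_sum (s := Finset.univ) fun j _ => hentry j)
  rw [Finset.sum_ite, Finset.sum_const_zero, add_zero, Finset.sum_const, nsmul_eq_mul]
  simpa using hcard

theorem volume_bridgeSet_pos (p : ℕ) : 0 < volume (bridgeSet p) := by
  have hsub : (Set.univ.pi fun _ : Fin p => Set.Icc (0 : ℝ) (1 / 2)) ⊆ bridgeSet p := by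
    refine fun u hu => ⟨fun j => (hu j trivial).1, neg_one_le_secondDiff_mulVec ?_ ?_⟩ <;>
      refine Fin.lastCases (by simp) fun j => ?_
    · simpa using (hu j trivial).1
    · simpa using (hu j trivial).2
  refine lt_of_lt_of_le ?_ (measure_mono hsub)
  rw [volume_pi_pi, Finset.prod_const, Real.volume_Icc]
  exact ENNReal.pow_pos (by simp) _

theorem measurableSet_slice (p : ℕ) (s : ℝ) :
    MeasurableSet {u : Fin p → ℝ | 0 ≤ u ∧ 0 ≤ bridge u + s • 1} :=
  ((isClosed_le continuous_const continuous_id).inter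
    (isClosed_le continuous_const ((continuous_bridge p).add continuous_const))).measurableSet

theorem setLIntegral_slice {p : ℕ} {s : ℝ} (hs : 0 < s) (f : (Fin p → ℝ) → ℝ≥0∞) :
    ∫⁻ u in {u : Fin p → ℝ | 0 ≤ u ∧ 0 ≤ bridge u + s • 1}, f u =
      ENNReal.ofReal (s ^ p) * ∫⁻ z in bridgeSet p, f (s • z) := by
  rw [← lintegral_indicator (measurableSet_slice p s),
    ← lintegral_indicator (measurableSet_bridgeSet p),
    ← lintegral_comp_smul_of_pos volume _ hs, Module.finrank_fin_fun]
  refine congrArg _ (lintegral_congr fun z => ?_)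
  exact Set.indicator_eq_indicator (smul_mem_slice_iff hs z) rfl

/-! ### Growth of the coefficients -/

theorem slice_le_lintegral {p : ℕ} {H : (Fin (p + 1) → ℝ) → ℝ≥0∞} (hH : Measurable H) (s : ℝ)
    {F : (Fin p → ℝ) → ℝ≥0∞}
    (h : ∀ u, ∀ θ ∈ Set.Icc (0 : ℝ) 1, F u ≤ H (bridge u + θ • Pi.single 0 1 + s • 1)) :
    ENNReal.ofReal (p + 1) * ∫⁻ u, F u ≤ ∫⁻ x, H x := by
  rw [← lintegral_add_right_eq_self H (s • 1),
    lintegral_slices_single (H := fun x => H (x + s • 1)) (hH.comp (measurable_add_const _))]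
  gcongr
  calc ∫⁻ u, F u = ∫⁻ _ in Set.Icc (0 : ℝ) 1, ∫⁻ u, F u := by simp
    _ ≤ ∫⁻ θ in Set.Icc (0 : ℝ) 1,
          ∫⁻ u : Fin p → ℝ, H (bridge u + θ • Pi.single 0 1 + s • 1) :=
        setLIntegral_mono' measurableSet_Icc fun θ hθ => lintegral_mono fun u => h u θ hθ
    _ ≤ _ := setLIntegral_le_lintegral _ _

/-- The solid simplex of the nonnegative vectors with sum at most `r`. -/
def solidSimplex (n : ℕ) (r : ℝ) : Set (Fin n → ℝ) := {x | 0 ≤ x ∧ ∑ i, x i ≤ r}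

theorem measurableSet_solidSimplex (n : ℕ) (r : ℝ) : MeasurableSet (solidSimplex n r) :=
  ((isClosed_le continuous_const continuous_id).inter
    (isClosed_le (f := fun x : Fin n → ℝ => ∑ i, x i) (by fun_prop)
      continuous_const)).measurableSet

theorem solidSimplex_eq_empty {n : ℕ} {r : ℝ} (hr : r < 0) : solidSimplex n r = ∅ :=
  Set.eq_empty_of_forall_notMem fun _ hx =>
    (hx.2.trans_lt hr).not_ge (Finset.sum_nonneg fun i _ => hx.1 i)

theorem snoc_mem_solidSimplex {n : ℕ} {r τ : ℝ} {u : Fin n → ℝ} :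
    (Fin.snoc u τ : Fin (n + 1) → ℝ) ∈ solidSimplex (n + 1) r ↔
      0 ≤ τ ∧ u ∈ solidSimplex n (r - τ) := by
  simp only [solidSimplex, Set.mem_ofPred_eq, Fin.sum_univ_castSucc, Fin.snoc_castSucc,
    Fin.snoc_last, Pi.le_def, Pi.zero_apply, Fin.forall_fin_succ', le_sub_iff_add_le]
  tauto

theorem volume_eq_lintegral_snoc {p : ℕ} {s : Set (Fin (p + 1) → ℝ)} (hs : MeasurableSet s) :
    volume s = ∫⁻ τ : ℝ, volume {u : Fin p → ℝ | (Fin.snoc u τ : Fin (p + 1) → ℝ) ∈ s} := by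
  rw [← lintegral_indicator_one hs, volume_pi, lintegral_pi_snoc _ (measurable_one.indicator hs),
    ← volume_pi]
  refine lintegral_congr fun τ => ?_
  have hsnoc : Measurable fun u : Fin p → ℝ => (Fin.snoc u τ : Fin (p + 1) → ℝ) :=
    (Continuous.finSnoc (A := fun _ => ℝ) continuous_id (continuous_const (y := τ))).measurable
  exact lintegral_indicator_one (hsnoc hs)

theorem volume_solidSimplex_succ (n : ℕ) (r : ℝ) :
    volume (solidSimplex (n + 1) r) =
      ∫⁻ τ in Set.Icc 0 r, volume (solidSimplex n (r - τ)) := by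
  rw [volume_eq_lintegral_snoc (measurableSet_solidSimplex _ _),
    ← lintegral_indicator measurableSet_Icc]
  refine lintegral_congr fun τ => ?_
  simp only [snoc_mem_solidSimplex]
  by_cases hτ : τ ∈ Set.Icc 0 r
  · simp [Set.indicator_of_mem hτ, hτ.1]
  · rw [Set.indicator_of_notMem hτ]
    convert measure_empty (μ := (volume : Measure (Fin n → ℝ)))
    refine Set.eq_empty_of_forall_notMem fun u ⟨h0, hu⟩ => ?_
    rw [solidSimplex_eq_empty (sub_neg.2 (not_le.1 fun hr => hτ ⟨h0, hr⟩))] at hu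
    exact hu

theorem volume_solidSimplex (n : ℕ) {r : ℝ} (hr : 0 ≤ r) :
    volume (solidSimplex n r) = ENNReal.ofReal (r ^ n / n !) := by
  induction n generalizing r with
  | zero =>
    rw [show solidSimplex 0 r = Set.univ from
      Set.eq_univ_of_forall fun x => ⟨fun i => i.elim0, by simpa using hr⟩,
      Measure.volume_pi_eq_dirac]
    simp
  | succ n ih =>
    have hpow : ∫⁻ τ in Set.Icc 0 r, ENNReal.ofReal ((r - τ) ^ n / n !) =
        ENNReal.ofReal (∫ τ in Set.Icc 0 r, (r - τ) ^ n / n !) := by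
      refine (ofReal_integral_eq_lintegral_ofReal ?_ ?_).symm
      · exact (Continuous.continuousOn (by fun_prop)).integrableOn_Icc
      · refine (ae_restrict_iff' measurableSet_Icc).2 (ae_of_all _ fun τ hτ => ?_)
        have : 0 ≤ r - τ := sub_nonneg.2 hτ.2
        positivity
    rw [volume_solidSimplex_succ,
      setLIntegral_congr_fun measurableSet_Icc fun τ hτ => ih (sub_nonneg.2 hτ.2), hpow,
      integral_Icc_eq_integral_Ioc, ← intervalIntegral.integral_of_le hr,
      intervalIntegral.integral_comp_sub_left (fun x => x ^ n / (n ! : ℝ)) r,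
      intervalIntegral.integral_div, integral_pow, Nat.factorial_succ]
    congr 1
    simp only [sub_self, sub_zero, ne_eq, Nat.add_eq_zero_iff, one_ne_zero, and_false,
      not_false_eq_true, zero_pow, Nat.cast_mul, Nat.cast_add, Nat.cast_one]
    field_simp

theorem bridge_add_mem_solidSimplex {p : ℕ} {u : Fin p → ℝ} (hu : u ∈ bridgeSet p) {θ : ℝ}
    (hθ : θ ∈ Set.Icc (0 : ℝ) 1) :
    bridge u + θ • Pi.single 0 1 + (1 : ℝ) • 1 ∈ solidSimplex (p + 1) (p + 2) := by
  have hsingle : (0 : Fin (p + 1) → ℝ) ≤ θ • Pi.single 0 1 :=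
    smul_nonneg hθ.1 (Pi.single_nonneg.2 zero_le_one)
  refine ⟨?_, ?_⟩
  · rw [one_smul, add_right_comm]
    exact add_nonneg (neg_le_iff_add_nonneg.1 hu.2) hsingle
  · have hlast := lastEntry_nonneg hu.1
    simp only [Pi.add_apply, Finset.sum_add_distrib, sum_bridge, Pi.smul_apply, smul_eq_mul,
      ← Finset.mul_sum, Finset.sum_pi_single', Finset.mem_univ, if_true, Pi.one_apply,
      Finset.sum_const, Finset.card_fin, nsmul_eq_mul, Nat.cast_add, Nat.cast_one]
    linarith [hθ.2]

theorem volume_bridgeSet_le (p : ℕ) :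
    ENNReal.ofReal (p + 1) * volume (bridgeSet p) ≤
      ENNReal.ofReal ((p + 2 : ℝ) ^ (p + 1) / (p + 1)!) := by
  have hsimplex := measurableSet_solidSimplex (p + 1) (p + 2)
  rw [← volume_solidSimplex (p + 1) (by positivity), ← lintegral_indicator_one hsimplex,
    ← lintegral_indicator_one (measurableSet_bridgeSet p)]
  refine slice_le_lintegral (measurable_one.indicator hsimplex) 1 fun u θ hθ => ?_
  by_cases hu : u ∈ bridgeSet p
  · rw [Set.indicator_of_mem hu, Set.indicator_of_mem (bridge_add_mem_solidSimplex hu hθ)]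
    exact le_rfl
  · rw [Set.indicator_of_notMem hu]
    exact zero_le

theorem volume_bridgeSet_lt_top (p : ℕ) : volume (bridgeSet p) < ∞ := by
  have h := (volume_bridgeSet_le p).trans_lt ENNReal.ofReal_lt_top
  exact ENNReal.lt_top_of_mul_ne_top_right h.ne (ENNReal.ofReal_pos.2 (by positivity)).ne'

theorem c_pos (p : ℕ) : 0 < c (p + 1) := by
  rw [c_succ]
  exact mul_pos (l_pos p)
    (ENNReal.toReal_pos (volume_bridgeSet_pos p).ne' (volume_bridgeSet_lt_top p).ne)

theorem c_succ_le (p : ℕ) : c (p + 1) ≤ (p + 2 : ℝ) ^ (p + 2) / (2 * (p + 1)!) := by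
  have h := ENNReal.toReal_mono ENNReal.ofReal_ne_top (volume_bridgeSet_le p)
  rw [ENNReal.toReal_mul, ENNReal.toReal_ofReal (by positivity),
    ENNReal.toReal_ofReal (by positivity), ← Measure.real] at h
  calc c (p + 1) = ((p : ℝ) + 2) / 2 * ((p + 1) * volume.real (bridgeSet p)) := by
        rw [c_succ, l]; push_cast; ring
    _ ≤ ((p : ℝ) + 2) / 2 * ((p + 2 : ℝ) ^ (p + 1) / (p + 1)!) := by gcongr
    _ = (p + 2 : ℝ) ^ (p + 2) / (2 * (p + 1)!) := by rw [pow_succ _ (p + 1)]; field_simp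

theorem sqrt_mul_pow_le_factorial (n : ℕ) :
    Real.sqrt n * (n / Real.exp 1) ^ n ≤ n ! := by
  refine le_trans ?_ (Stirling.le_factorial_stirling n)
  gcongr
  nlinarith [Real.pi_gt_three, Nat.cast_nonneg (α := ℝ) n]

theorem add_one_pow_le_exp_mul_pow (n : ℕ) : ((n : ℝ) + 1) ^ n ≤ Real.exp 1 * n ^ n := by
  rcases n.eq_zero_or_pos with rfl | hn
  · simp
  calc ((n : ℝ) + 1) ^ n = (1 / (n : ℝ) + 1) ^ n * n ^ n := by
        rw [← mul_pow, add_comm (1 / (n : ℝ))]; congr 1; field_simp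
    _ ≤ Real.exp (1 / n) ^ n * n ^ n := by gcongr; exact Real.add_one_le_exp _
    _ = Real.exp 1 * n ^ n := by rw [← Real.exp_nat_mul]; congr 2; field_simp

theorem c_succ_le_sqrt_mul_exp (p : ℕ) :
    c (p + 1) ≤ Real.exp 1 * (Real.sqrt (p + 1 : ℕ) * Real.exp (p + 1 : ℕ)) := by
  have hc : c (p + 1) ≤ ((p + 1 : ℕ) + 1 : ℝ) ^ (p + 1 + 1) / (2 * (p + 1)!) := by
    refine (c_succ_le p).trans_eq ?_
    push_cast; ring
  have hn : (1 : ℝ) ≤ (p + 1 : ℕ) := by simp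
  generalize p + 1 = n at hc hn ⊢
  refine hc.trans ?_
  rw [div_le_iff₀ (by positivity)]
  calc ((n : ℝ) + 1) ^ (n + 1) = (n + 1) ^ n * (n + 1) := pow_succ _ _
    _ ≤ (Real.exp 1 * n ^ n) * (2 * n) := by
        gcongr
        · exact add_one_pow_le_exp_mul_pow n
        · linarith
    _ = Real.exp 1 * (Real.sqrt n * Real.exp n) * (2 * (Real.sqrt n * (n / Real.exp 1) ^ n)) := by
        rw [div_pow, ← mul_one (n : ℝ), Real.exp_nat_mul, mul_one]
        field_simp
        rw [Real.sq_sqrt n.cast_nonneg]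
    _ ≤ Real.exp 1 * (Real.sqrt n * Real.exp n) * (2 * n !) := by
        gcongr; exact sqrt_mul_pow_le_factorial n

theorem c_isBigO : c =O[atTop] fun k : ℕ => Real.sqrt k * Real.exp k := by
  refine IsBigO.of_bound (Real.exp 1) ?_
  filter_upwards [eventually_ge_atTop 1] with k hk
  obtain ⟨p, rfl⟩ := Nat.exists_eq_add_of_le' hk
  rw [Real.norm_of_nonneg (c_pos p).le, Real.norm_of_nonneg (by positivity)]
  exact c_succ_le_sqrt_mul_exp p

theorem mul_exp_neg_le {t b : ℝ} (htb : t ≤ b) (hb0 : 0 ≤ b) (hb : b ≤ 1) :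
    t * Real.exp (-t) ≤ b * Real.exp (-b) := by
  have htangent : t ≤ b * Real.exp (t - b) := by
    nlinarith [mul_le_mul_of_nonneg_left (Real.add_one_le_exp (t - b)) hb0]
  calc t * Real.exp (-t) ≤ b * Real.exp (t - b) * Real.exp (-t) := by gcongr
    _ = b * Real.exp (-b) := by rw [mul_assoc, ← Real.exp_add]; congr 2; ring

theorem mul_exp_neg_lt {t : ℝ} (ht : t ≠ 1) : t * Real.exp (-t) < Real.exp (-1) := by
  calc t * Real.exp (-t) = (t - 1 + 1) * Real.exp (-t) := by ring
    _ < Real.exp (t - 1) * Real.exp (-t) := by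
        gcongr; exact Real.add_one_lt_exp (sub_ne_zero.2 ht)
    _ = Real.exp (-1) := by rw [← Real.exp_add]; congr 1; ring

theorem c_succ_mul_pow_le {q : ℝ} (hq : 0 ≤ q) (k : ℕ) :
    c (k + 1) * q ^ k ≤ Real.exp 1 ^ 2 * (((k : ℝ) + 1) * (q * Real.exp 1) ^ k) := by
  have hsqrt : Real.sqrt (k + 1 : ℕ) ≤ k + 1 := by
    rw [Real.sqrt_le_left (by positivity)]
    push_cast
    nlinarith [Nat.cast_nonneg (α := ℝ) k]
  calc c (k + 1) * q ^ k ≤ Real.exp 1 * ((k + 1) * Real.exp (k + 1 : ℕ)) * q ^ k := by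
        gcongr
        exact (c_succ_le_sqrt_mul_exp k).trans (by gcongr)
    _ = Real.exp 1 ^ 2 * ((k + 1) * (q * Real.exp 1) ^ k) := by
        rw [← mul_one ((k + 1 : ℕ) : ℝ), Real.exp_nat_mul, pow_succ, mul_pow]
        ring

theorem summable_c_mul_pow {q : ℝ} (hq0 : 0 ≤ q) (hq : q < Real.exp (-1)) :
    Summable fun k : ℕ => c (k + 1) * q ^ k := by
  have hr : ‖q * Real.exp 1‖ < 1 := by
    rwa [Real.norm_of_nonneg (by positivity), ← lt_div_iff₀ (Real.exp_pos 1), one_div,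
      ← Real.exp_neg]
  have hsum : Summable fun k : ℕ => ((k : ℝ) + 1) * (q * Real.exp 1) ^ k := by
    simpa only [pow_one, add_mul, one_mul] using
      (summable_pow_mul_geometric_of_norm_lt_one 1 hr).add (summable_geometric_of_norm_lt_one hr)
  exact .of_nonneg_of_le (fun k => mul_nonneg (c_pos k).le (by positivity))
    (c_succ_mul_pow_le hq0) (hsum.mul_left _)

theorem summable_c_mul_exp {t : ℝ} (ht : t ∈ Set.Ico (0 : ℝ) 1) :
    Summable fun k : ℕ => c (k + 1) * (t * Real.exp (-t)) ^ k :=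
  summable_c_mul_pow (mul_nonneg ht.1 (Real.exp_pos _).le) (mul_exp_neg_lt ht.2.ne)

/-! ### The law of the increments -/

theorem lintegral_pi_withDensity {α : Type*} [MeasurableSpace α] (μ : Measure α) [SigmaFinite μ]
    {f : α → ℝ≥0∞} (hf : Measurable f) [SigmaFinite (μ.withDensity f)] (n : ℕ)
    {F : (Fin n → α) → ℝ≥0∞} (hF : Measurable F) :
    ∫⁻ x, F x ∂Measure.pi (fun _ => μ.withDensity f) =
      ∫⁻ x, (∏ i, f (x i)) * F x ∂Measure.pi (fun _ => μ) := by
  induction n with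
  | zero => rw [Measure.pi_of_empty, Measure.pi_of_empty]; simp
  | succ n ih =>
    have hprod (m : ℕ) : Measurable fun x : Fin m → α => ∏ i, f (x i) := by fun_prop
    have hsnoc : Measurable fun q : α × (Fin n → α) => F (Fin.snoc q.2 q.1) := by
      refine hF.comp (measurable_pi_lambda _ fun i => ?_)
      refine Fin.lastCases ?_ (fun i => ?_) i
      · simpa using measurable_fst
      · simpa using (measurable_pi_apply i).fun_comp measurable_snd
    have hsnoc_right (τ : α) : Measurable fun u : Fin n → α => F (Fin.snoc u τ) :=
      hsnoc.comp measurable_prodMk_left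
    have hsnoc_prod := lintegral_pi_snoc μ ((hprod (n + 1)).mul hF)
    simp only [Pi.mul_apply] at hsnoc_prod
    rw [lintegral_pi_snoc _ hF, hsnoc_prod, lintegral_withDensity_eq_lintegral_mul _ hf
        hsnoc.lintegral_prod_right']
    refine lintegral_congr fun τ => ?_
    simp only [Pi.mul_apply]
    rw [ih (hsnoc_right τ),
      ← lintegral_const_mul _ (f := fun u => (∏ i, f (u i)) * F (Fin.snoc u τ))
        ((hprod n).mul (hsnoc_right τ))]
    refine lintegral_congr fun u => ?_
    simp only [Fin.prod_univ_castSucc, Fin.snoc_castSucc, Fin.snoc_last]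
    ring

theorem prod_exponentialPDF {n : ℕ} (x : Fin n → ℝ) :
    ∏ i, exponentialPDF 1 (x i) =
      (Set.Ici (0 : Fin n → ℝ)).indicator (fun x => ENNReal.ofReal (Real.exp (-∑ i, x i))) x := by
  by_cases hx : 0 ≤ x
  · rw [Set.indicator_of_mem (Set.mem_Ici.2 hx), ← Finset.sum_neg_distrib, Real.exp_sum,
      ENNReal.ofReal_prod_of_nonneg fun i _ => (Real.exp_pos _).le]
    exact Finset.prod_congr rfl fun i _ => by rw [exponentialPDF_of_nonneg (hx i)]; simp
  · rw [Set.indicator_of_notMem (mt Set.mem_Ici.1 hx)]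
    simp only [Pi.le_def, not_forall, not_le, Pi.zero_apply] at hx
    obtain ⟨i, hi⟩ := hx
    exact Finset.prod_eq_zero (Finset.mem_univ i) (exponentialPDF_of_neg hi)

instance isProbabilityMeasure_expMeasure_one : IsProbabilityMeasure (expMeasure 1) :=
  isProbabilityMeasure_expMeasure one_pos

/-- The law of `n` independent standard exponential variables. -/
def stdExp (n : ℕ) : Measure (Fin n → ℝ) := Measure.pi fun _ => expMeasure 1

instance isProbabilityMeasure_stdExp (n : ℕ) : IsProbabilityMeasure (stdExp n) :=
  inferInstanceAs (IsProbabilityMeasure (Measure.pi fun _ => expMeasure 1))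

theorem lintegral_stdExp {n : ℕ} {F : (Fin n → ℝ) → ℝ≥0∞} (hF : Measurable F) :
    ∫⁻ x, F x ∂stdExp n =
      ∫⁻ x in Set.Ici (0 : Fin n → ℝ), ENNReal.ofReal (Real.exp (-∑ i, x i)) * F x := by
  have : SigmaFinite ((volume : Measure ℝ).withDensity (exponentialPDF 1)) :=
    inferInstanceAs (SigmaFinite (expMeasure 1))
  refine (lintegral_pi_withDensity volume
    (measurable_exponentialPDFReal 1).ennreal_ofReal n hF).trans ?_
  rw [← lintegral_indicator measurableSet_Ici]
  refine lintegral_congr fun x => ?_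
  rw [Set.indicator_mul_left, ← prod_exponentialPDF]
  rfl

/-- The increments of the walks with the area at least `s l_j + j a` for every `j ≤ m`. -/
def survivalSet (m : ℕ) (s a : ℝ) : Set (Fin m → ℝ) :=
  {x | ∀ j ∈ Finset.Icc 1 m, s * l j + j * a ≤ area x j}

/-- The probability that a walk with standard exponential increments has the area at least
`s l_j + j a` for every `j ≤ m`. -/
def survival (m : ℕ) (s a : ℝ) : ℝ≥0∞ := stdExp m (survivalSet m s a)

theorem survival_zero (s a : ℝ) : survival 0 s a = 1 := by
  simp [survival, survivalSet]

theorem measurableSet_survivalSet_prod (m : ℕ) :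
    MeasurableSet {q : (ℝ × ℝ) × (Fin m → ℝ) | q.2 ∈ survivalSet m q.1.1 q.1.2} := by
  change MeasurableSet {q : (ℝ × ℝ) × (Fin m → ℝ) |
    ∀ j ∈ Finset.Icc 1 m, q.1.1 * l j + j * q.1.2 ≤ area q.2 j}
  simp only [Set.ofPred_forall]
  refine Finset.measurableSet_biInter _ fun j _ => measurableSet_le (by fun_prop) ?_
  exact (continuous_area j).measurable.comp measurable_snd

theorem measurableSet_survivalSet (m : ℕ) (s a : ℝ) : MeasurableSet (survivalSet m s a) :=
  measurable_prodMk_left (x := (s, a)) (measurableSet_survivalSet_prod m)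

theorem measurable_survival (m : ℕ) : Measurable fun q : ℝ × ℝ => survival m q.1 q.2 :=
  measurable_measure_prodMk_left (measurableSet_survivalSet_prod m)

theorem add_smul_single_mem_survivalSet {m : ℕ} (s a : ℝ) (x : Fin (m + 1) → ℝ) :
    x + a • Pi.single 0 1 ∈ survivalSet (m + 1) s a ↔ x ∈ survivalSet (m + 1) s 0 := by
  simp only [survivalSet, Set.mem_ofPred_eq, area_add, area_smul, area_single]
  refine forall₂_congr fun j _ => ?_
  rw [mul_comm a, add_le_add_iff_right, mul_zero, add_zero]

theorem zero_apply_nonneg_of_mem_survivalSet {m : ℕ} {s : ℝ} (hs : 0 ≤ s) {x : Fin (m + 1) → ℝ}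
    (hx : x ∈ survivalSet (m + 1) s 0) : 0 ≤ x 0 := by
  have h := hx 1 (by simp)
  have harea : area x 1 = x 0 := by simp [area, Fin.sum_univ_succ]
  rw [harea, mul_zero, add_zero] at h
  exact (mul_nonneg hs (l_pos 0).le).trans h

/-- Memorylessness: the first increment alone absorbs the shift `a`. -/
theorem survival_eq_exp_mul (m : ℕ) {s a : ℝ} (hs : 0 ≤ s) (ha : 0 ≤ a) :
    survival (m + 1) s a = ENNReal.ofReal (Real.exp (-a)) * survival (m + 1) s 0 := by
  have hdensity (a : ℝ) : survival (m + 1) s a = ∫⁻ x in survivalSet (m + 1) s a ∩ Set.Ici 0,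
      ENNReal.ofReal (Real.exp (-∑ i, x i)) := by
    rw [survival, ← lintegral_indicator_one (measurableSet_survivalSet _ _ _),
      lintegral_stdExp (measurable_one.indicator (measurableSet_survivalSet _ _ _)),
      ← Measure.restrict_restrict (measurableSet_survivalSet _ _ _),
      ← lintegral_indicator (measurableSet_survivalSet _ _ _)]
    refine lintegral_congr fun x => ?_
    by_cases hx : x ∈ survivalSet (m + 1) s a <;> simp [hx]
  have hmeas (a : ℝ) : MeasurableSet (survivalSet (m + 1) s a ∩ Set.Ici 0) :=
    (measurableSet_survivalSet _ _ _).inter measurableSet_Ici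
  rw [hdensity, hdensity, ← lintegral_const_mul' _ _ ENNReal.ofReal_ne_top,
    ← lintegral_indicator (hmeas a), ← lintegral_indicator (hmeas 0),
    ← lintegral_add_right_eq_self _ (a • (Pi.single 0 1 : Fin (m + 1) → ℝ))]
  refine lintegral_congr fun x => Set.indicator_eq_indicator ?_ ?_
  · rw [Set.mem_inter_iff, Set.mem_inter_iff, add_smul_single_mem_survivalSet]
    refine and_congr_right fun hx => ?_
    have h0 := zero_apply_nonneg_of_mem_survivalSet hs hx
    simp only [Set.mem_Ici, Pi.le_def, Fin.forall_fin_succ]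
    simp [h0, add_nonneg h0 ha]
  · rw [← ENNReal.ofReal_mul (Real.exp_pos _).le, ← Real.exp_add]
    simp [Finset.sum_add_distrib, ← Finset.mul_sum]

section Shift

variable {Ω : Type*} {X : ℕ → Ω → ℝ}

/-- The vector of the first `n` increments. -/
def past (X : ℕ → Ω → ℝ) (n : ℕ) (ω : Ω) : Fin n → ℝ := fun i => X i ω

theorem Y_eq_area_div {j n : ℕ} (h : j ≤ n) (ω : Ω) : Y X j ω = area (past X n ω) j / l j := by
  have harea : area (past X n ω) j = ∑ k ∈ Finset.Icc 1 j, S X k ω :=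
    area_eq_sum_partialSums (fun i => X i ω) h
  rw [harea, Y, l, div_div_eq_mul_div, div_mul_eq_mul_div, mul_comm]

theorem le_Y_iff {j n : ℕ} (hj : 1 ≤ j) (h : j ≤ n) (ω : Ω) (t : ℝ) :
    t ≤ Y X j ω ↔ t * l j ≤ area (past X n ω) j := by
  obtain ⟨i, rfl⟩ := Nat.exists_eq_add_of_le' hj
  rw [Y_eq_area_div h, le_div_iff₀ (l_pos i)]

theorem area_past_add (k m j : ℕ) (ω : Ω) :
    area (past X (k + m) ω) (k + j) =
      area (past X k ω) k + j * ∑ i, past X k ω i + area (past (fun i => X (k + i)) m ω) j := by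
  rw [← area_add_eq, area, Fin.sum_univ_add]
  simp [area, past, Nat.add_sub_add_left]

theorem setOf_le_iInf_Y (n : ℕ) (t : ℝ) :
    {ω | (t : EReal) ≤ ⨅ k ∈ Finset.Icc 1 n, (Y X k ω : EReal)} =
      {ω | ∀ k ∈ Finset.Icc 1 n, t ≤ Y X k ω} := by
  ext ω; simp only [Set.mem_ofPred_eq, le_iInf_iff, EReal.coe_le_coe_iff]

end Shift

section Law

variable {Ω : Type*} [MeasurableSpace Ω] {P : Measure Ω} {X : ℕ → Ω → ℝ}

theorem hasLaw_past (hlaw : ∀ i, HasLaw (X i) (expMeasure 1) P) (hindep : iIndepFun X P) (n : ℕ) :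
    HasLaw (past X n) (stdExp n) P :=
  iIndepFun.hasLaw_pi (fun i : Fin n => hlaw i) (hindep.precomp Fin.val_injective)

theorem indepFun_past_shift (hX : ∀ i, AEMeasurable (X i) P) (hindep : iIndepFun X P) (k m : ℕ) :
    IndepFun (past X k) (past (fun i => X (k + i)) m) P := by
  have hdisj : Disjoint (Finset.range k) (Finset.Ico k (k + m)) :=
    Finset.disjoint_left.2 fun i hi hi' => by
      simp only [Finset.mem_range, Finset.mem_Ico] at hi hi'; omega
  have hpast : Measurable fun (z : Finset.range k → ℝ) (i : Fin k) => z ⟨i, by simp⟩ := by fun_prop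
  have hfuture : Measurable fun (z : Finset.Ico k (k + m) → ℝ) (i : Fin m) =>
      z ⟨k + i, by simp⟩ := by fun_prop
  exact (hindep.indepFun_finset₀ _ _ hdisj hX).comp hpast hfuture

theorem hasLaw_past_shift [IsProbabilityMeasure P] (hlaw : ∀ i, HasLaw (X i) (expMeasure 1) P)
    (hindep : iIndepFun X P) (k m : ℕ) :
    HasLaw (fun ω => (past X k ω, past (fun i => X (k + i)) m ω))
      ((stdExp k).prod (stdExp m)) P := by
  refine IndepFun.hasLaw_prod (hasLaw_past hlaw hindep k) (hasLaw_past (fun i => hlaw (k + i))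
    (hindep.precomp (add_right_injective k)) m) ?_
  exact indepFun_past_shift (fun i => (hlaw i).aemeasurable) hindep k m

theorem survival_eq_Gn [IsProbabilityMeasure P] (hlaw : ∀ i, HasLaw (X i) (expMeasure 1) P)
    (hindep : iIndepFun X P) (m : ℕ) (t : ℝ) :
    survival m t 0 = ENNReal.ofReal (Gn P X m t) := by
  rw [Gn, ofReal_measureReal, setOf_le_iInf_Y]
  refine ((hasLaw_past hlaw hindep m).measure_eq (p := (· ∈ survivalSet m t 0))
    (measurableSet_survivalSet m t 0)).symm.trans ?_
  congr 1 with ω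
  simp only [survivalSet, Set.mem_ofPred_eq, mul_zero, add_zero]
  refine forall₂_congr fun j hj => ?_
  rw [Finset.mem_Icc] at hj
  exact (le_Y_iff hj.1 hj.2 ω t).symm

end Law

/-! ### The first minimum -/

/-- The normalized area at the final time of the walk with the increments `x`. -/
def finalHeight {n : ℕ} (x : Fin n → ℝ) : ℝ := area x n / l n

/-- The increments of the walks whose normalized areas have a strict minimum at the final time. -/
def strictMinSet (p : ℕ) : Set (Fin (p + 1) → ℝ) :=
  {x | ∀ j : Fin p, finalHeight x * l (j + 1) < area x (j + 1)}

theorem measurable_finalHeight (n : ℕ) : Measurable fun x : Fin n → ℝ => finalHeight x :=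
  (continuous_area n).measurable.div_const _

theorem measurableSet_strictMinSet (p : ℕ) : MeasurableSet (strictMinSet p) := by
  rw [strictMinSet, Set.ofPred_forall]
  exact MeasurableSet.iInter fun j => measurableSet_lt
    ((measurable_finalHeight _).mul_const _) (continuous_area _).measurable

theorem area_bridge_add {p j : ℕ} (hj : j ≤ p + 1) (u : Fin p → ℝ) (s : ℝ) :
    area (bridge u + s • 1) j = area (bridge u) j + s * l j := by
  rw [area_add, area_smul, area_one hj]

theorem finalHeight_bridge_add {p : ℕ} (u : Fin p → ℝ) (s : ℝ) :
    finalHeight (bridge u + s • 1) = s := by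
  rw [finalHeight, area_bridge_add le_rfl, area_bridge_last, zero_add,
    mul_div_cancel_right₀ _ (l_pos p).ne']

theorem bridge_add_mem_strictMinSet {p : ℕ} (u : Fin p → ℝ) (s : ℝ) :
    bridge u + s • 1 ∈ strictMinSet p ↔ ∀ j, 0 < u j := by
  refine forall_congr' fun j => ?_
  rw [finalHeight_bridge_add, area_bridge_add (by omega), area_bridge, lt_add_iff_pos_left]

theorem sum_bridge_add {p : ℕ} (u : Fin p → ℝ) (s : ℝ) :
    ∑ i, (bridge u + s • 1) i = s * (p + 1) - lastEntry u := by
  simp only [Pi.add_apply, Finset.sum_add_distrib, sum_bridge]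
  simp [mul_comm, sub_eq_neg_add]

theorem nonneg_of_bridge_add_nonneg {p : ℕ} {u : Fin p → ℝ} {s : ℝ} (h : 0 ≤ bridge u + s • 1) :
    0 ≤ s := by
  rw [← finalHeight_bridge_add u s]
  exact div_nonneg (area_nonneg h _) (l_pos p).le

theorem ae_pos_iff_nonneg (ι : Type*) [Fintype ι] :
    ∀ᵐ u : ι → ℝ, (∀ j, 0 < u j) ↔ 0 ≤ u := by
  have h : ∀ᵐ u : ι → ℝ, ∀ j, u j ≠ 0 :=
    ae_all_iff.2 fun j => Measure.ae_eval_ne (μ := fun _ : ι => (volume : Measure ℝ)) j 0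
  filter_upwards [h] with u hu
  exact ⟨fun h j => (h j).le, fun h j => lt_of_le_of_ne (h j) (hu j).symm⟩

theorem lintegral_stdExp_strictMinSet {p : ℕ} {F : (Fin (p + 1) → ℝ) → ℝ≥0∞} (hF : Measurable F) :
    ∫⁻ x in strictMinSet p, F x ∂stdExp (p + 1) = ENNReal.ofReal (l (p + 1)) *
      ∫⁻ s in Set.Ioi (0 : ℝ), ∫⁻ u in {u : Fin p → ℝ | 0 ≤ u ∧ 0 ≤ bridge u + s • 1},
        ENNReal.ofReal (Real.exp (lastEntry u - (p + 1) * s)) * F (bridge u + s • 1) := by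
  have hF' := hF.indicator (measurableSet_strictMinSet p)
  have hintegrand : Measurable ((Set.Ici 0).indicator fun x : Fin (p + 1) → ℝ =>
      ENNReal.ofReal (Real.exp (-∑ i, x i)) * (strictMinSet p).indicator F x) :=
    Measurable.indicator (by fun_prop) measurableSet_Ici
  rw [← lintegral_indicator (measurableSet_strictMinSet p), lintegral_stdExp hF',
    ← lintegral_indicator measurableSet_Ici, lintegral_slices_l hintegrand,
    ← lintegral_indicator measurableSet_Ioi]
  congr 1
  have hne : ∀ᵐ s : ℝ, s ≠ 0 := by simp [ae_iff]
  refine lintegral_congr_ae ?_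
  filter_upwards [hne] with s hs
  by_cases hpos : 0 < s
  · rw [Set.indicator_of_mem (Set.mem_Ioi.2 hpos), ← lintegral_indicator (measurableSet_slice p s)]
    refine lintegral_congr_ae ?_
    filter_upwards [ae_pos_iff_nonneg (Fin p)] with u hu
    by_cases h2 : 0 ≤ bridge u + s • 1 <;> by_cases h1 : 0 ≤ u <;>
      simp only [Set.indicator, Set.mem_Ici, Set.mem_ofPred_eq, bridge_add_mem_strictMinSet, hu, h1,
        h2, sum_bridge_add, and_true, and_false, if_true, if_false, mul_zero]
    rw [neg_sub, mul_comm s]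
  · rw [Set.indicator_of_notMem (s := Set.Ioi (0 : ℝ)) hpos]
    refine (lintegral_congr fun u => ?_).trans lintegral_zero
    refine Set.indicator_of_notMem (fun h => hpos ?_) _
    exact lt_of_le_of_ne (nonneg_of_bridge_add_nonneg h) hs.symm

theorem lintegral_strictMinSet {p : ℕ} {Φ : ℝ × ℝ → ℝ≥0∞} (hΦ : Measurable Φ) :
    ∫⁻ x in strictMinSet p, Φ (finalHeight x, finalHeight x * (p + 1) - ∑ i, x i) ∂stdExp (p + 1) =
      ∫⁻ s in Set.Ioi (0 : ℝ), ENNReal.ofReal (l (p + 1) * s ^ p) * ∫⁻ z in bridgeSet p,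
        ENNReal.ofReal (Real.exp (s * lastEntry z - (p + 1) * s)) * Φ (s, s * lastEntry z) := by
  have hpair : Measurable fun x : Fin (p + 1) → ℝ =>
      (finalHeight x, finalHeight x * (p + 1) - ∑ i, x i) := by
    have := measurable_finalHeight (p + 1)
    fun_prop
  refine (lintegral_stdExp_strictMinSet (hΦ.comp hpair)).trans ?_
  rw [← lintegral_const_mul' _ _ ENNReal.ofReal_ne_top]
  refine setLIntegral_congr_fun measurableSet_Ioi fun s hs => ?_
  simp only [finalHeight_bridge_add, sum_bridge_add, sub_sub_cancel, Function.comp_apply]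
  rw [setLIntegral_slice hs, ← mul_assoc, ← ENNReal.ofReal_mul (l_pos p).le]
  simp only [lastEntry_smul]

/-- The event that the minimum of `Y_1, …, Y_n` is below `t` and is attained first at the time
`k`. -/
def firstMin {Ω : Type*} (X : ℕ → Ω → ℝ) (n k : ℕ) (t : ℝ) : Set Ω :=
  {ω | Y X k ω < t ∧ (∀ j ∈ Finset.Ico 1 k, Y X k ω < Y X j ω) ∧
    ∀ j ∈ Finset.Ioc k n, Y X k ω ≤ Y X j ω}

theorem past_mem_strictMinSet_iff {Ω : Type*} {X : ℕ → Ω → ℝ} (p : ℕ) (ω : Ω) :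
    past X (p + 1) ω ∈ strictMinSet p ↔
      ∀ j ∈ Finset.Ico 1 (p + 1), Y X (p + 1) ω < Y X j ω := by
  have hstep (i : ℕ) (hi : i < p) : finalHeight (past X (p + 1) ω) * l (i + 1) <
      area (past X (p + 1) ω) (i + 1) ↔ Y X (p + 1) ω < Y X (i + 1) ω := by
    rw [Y_eq_area_div (j := i + 1) (n := p + 1) (by omega), lt_div_iff₀ (l_pos i),
      finalHeight, ← Y_eq_area_div le_rfl]
  refine ⟨fun h j hj => ?_, fun h j => (hstep j j.isLt).2 (h (j + 1) (by simp))⟩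
  obtain ⟨i, rfl⟩ := Nat.exists_eq_add_of_le' (Finset.mem_Ico.1 hj).1
  have hi : i < p := by simpa using hj
  exact (hstep i hi).1 (h ⟨i, hi⟩)

theorem Y_le_Y_add_iff {Ω : Type*} {X : ℕ → Ω → ℝ} {p m j : ℕ} (h1 : 1 ≤ j) (hj : j ≤ m) (ω : Ω) :
    Y X (p + 1) ω ≤ Y X (p + 1 + j) ω ↔
      Y X (p + 1) ω * l j + j * (Y X (p + 1) ω * (p + 1) - ∑ i, past X (p + 1) ω i) ≤
        area (past (fun i => X (p + 1 + i)) m ω) j := by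
  have harea : area (past X (p + 1) ω) (p + 1) = Y X (p + 1) ω * l (p + 1) := by
    rw [Y_eq_area_div le_rfl, div_mul_cancel₀ _ (l_pos p).ne']
  rw [le_Y_iff (n := p + 1 + m) (by omega) (by omega), area_past_add, harea, l_add,
    ← sub_nonneg, ← sub_nonneg (b := _ + _)]
  push_cast
  ring_nf

theorem past_mem_survivalSet_iff {Ω : Type*} {X : ℕ → Ω → ℝ} (p m : ℕ) (ω : Ω) :
    past (fun i => X (p + 1 + i)) m ω ∈ survivalSet m (Y X (p + 1) ω)
        (Y X (p + 1) ω * (p + 1) - ∑ i, past X (p + 1) ω i) ↔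
      ∀ j ∈ Finset.Ioc (p + 1) (p + 1 + m), Y X (p + 1) ω ≤ Y X j ω := by
  rw [survivalSet, Set.mem_ofPred_eq]
  refine ⟨fun h j hj => ?_, fun h j hj => ?_⟩
  · rw [Finset.mem_Ioc] at hj
    obtain ⟨i, rfl⟩ := Nat.exists_eq_add_of_le hj.1.le
    exact (Y_le_Y_add_iff (by omega) (by omega) ω).2 (h i (by rw [Finset.mem_Icc]; omega))
  · rw [Finset.mem_Icc] at hj
    exact (Y_le_Y_add_iff hj.1 hj.2 ω).1 (h _ (by rw [Finset.mem_Ioc]; omega))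

theorem measure_firstMin {Ω : Type*} [MeasurableSpace Ω] {P : Measure Ω} [IsProbabilityMeasure P]
    {X : ℕ → Ω → ℝ} (hlaw : ∀ i, HasLaw (X i) (expMeasure 1) P) (hindep : iIndepFun X P)
    (p m : ℕ) (t : ℝ) :
    P (firstMin X (p + 1 + m) (p + 1) t) = ∫⁻ s in Set.Ioo 0 t,
      ENNReal.ofReal (l (p + 1) * s ^ p) * ∫⁻ z in bridgeSet p,
        ENNReal.ofReal (Real.exp (s * lastEntry z - (p + 1) * s)) *
          survival m s (s * lastEntry z) := by
  set slack : (Fin (p + 1) → ℝ) → ℝ := fun x => finalHeight x * (p + 1) - ∑ i, x i with hslack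
  set E : Set ((Fin (p + 1) → ℝ) × (Fin m → ℝ)) := {q | (q.1 ∈ strictMinSet p ∧
    finalHeight q.1 < t) ∧ q.2 ∈ survivalSet m (finalHeight q.1) (slack q.1)} with hE
  have hheight := measurable_finalHeight (p + 1)
  have hpair : Measurable fun x : Fin (p + 1) → ℝ => (finalHeight x, slack x) := by fun_prop
  have hbelow : MeasurableSet {x : Fin (p + 1) → ℝ | finalHeight x < t} :=
    measurableSet_lt hheight measurable_const
  have hEmeas : MeasurableSet E :=
    (measurable_fst ((measurableSet_strictMinSet p).inter hbelow)).inter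
      (((hpair.comp measurable_fst).prodMk measurable_snd) (measurableSet_survivalSet_prod m))
  have hevent : firstMin X (p + 1 + m) (p + 1) t =
      {ω | (past X (p + 1) ω, past (fun i => X (p + 1 + i)) m ω) ∈ E} := by
    ext ω
    have hfinal : finalHeight (past X (p + 1) ω) = Y X (p + 1) ω := (Y_eq_area_div le_rfl ω).symm
    simp only [firstMin, hE, hslack, Set.mem_ofPred_eq, hfinal, past_mem_survivalSet_iff,
      past_mem_strictMinSet_iff]
    tauto
  have hsection (x : Fin (p + 1) → ℝ) : stdExp m (Prod.mk x ⁻¹' E) = (strictMinSet p).indicator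
      (fun x => (Set.Iio t).indicator (fun s => survival m s (slack x)) (finalHeight x)) x := by
    by_cases hx : x ∈ strictMinSet p <;> by_cases hxt : finalHeight x < t <;>
      simp [hE, hx, hxt, survival, Set.preimage]
  have hΦ : Measurable fun q : ℝ × ℝ => (Set.Iio t).indicator (fun s => survival m s q.2) q.1 :=
    (measurable_survival m).indicator (measurable_fst measurableSet_Iio)
  rw [hevent, (hasLaw_past_shift hlaw hindep (p + 1) m).measure_eq (p := (· ∈ E)) hEmeas]
  refine (Measure.prod_apply hEmeas).trans ?_
  rw [lintegral_congr hsection, lintegral_indicator (measurableSet_strictMinSet p),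
    lintegral_strictMinSet hΦ, ← Set.Ioi_inter_Iio, Set.inter_comm,
    ← Measure.restrict_restrict measurableSet_Iio, ← lintegral_indicator measurableSet_Iio]
  refine lintegral_congr fun s => ?_
  by_cases hs : s ∈ Set.Iio t <;> simp [hs]

/-- The density of the minimum of `Y_1, …, Y_{p+1}` on the event that it is first attained at the
last step; its value at `s` is the contribution of that step to `-G_{p+1}'(s)`. -/
def lastDensity (p : ℕ) (s : ℝ) : ℝ :=
  l (p + 1) * s ^ p * Real.exp (-((p + 1) * s)) *
    ∫ z in bridgeSet p, Real.exp (s * lastEntry z)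

theorem norm_exp_mul_lastEntry_le {p : ℕ} (s : ℝ) {z : Fin p → ℝ} (hz : z ∈ bridgeSet p) :
    ‖Real.exp (s * lastEntry z)‖ ≤ Real.exp (|s| * (p + 1)) := by
  rw [Real.norm_of_nonneg (Real.exp_pos _).le, Real.exp_le_exp]
  exact mul_le_mul (le_abs_self s) (lastEntry_le hz) (lastEntry_nonneg hz.1) (abs_nonneg s)

theorem aestronglyMeasurable_exp_mul_lastEntry (p : ℕ) (s : ℝ) (μ : Measure (Fin p → ℝ)) :
    AEStronglyMeasurable (fun z => Real.exp (s * lastEntry z)) μ :=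
  (Real.continuous_exp.comp (continuous_const.mul
    (continuous_lastEntry p))).measurable.aestronglyMeasurable

theorem integrableOn_exp_mul_lastEntry (p : ℕ) (s : ℝ) :
    IntegrableOn (fun z => Real.exp (s * lastEntry z)) (bridgeSet p) :=
  Measure.integrableOn_of_bounded (volume_bridgeSet_lt_top p).ne
    (aestronglyMeasurable_exp_mul_lastEntry p s _)
    ((ae_restrict_iff' (measurableSet_bridgeSet p)).2
      (ae_of_all _ fun _ => norm_exp_mul_lastEntry_le s))

theorem continuous_lastDensity (p : ℕ) : Continuous (lastDensity p) := by
  refine Continuous.mul (by fun_prop) (continuous_iff_continuousAt.2 fun s₀ => ?_)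
  refine continuousAt_of_dominated (bound := fun _ => Real.exp ((|s₀| + 1) * (p + 1)))
    (Eventually.of_forall fun s => aestronglyMeasurable_exp_mul_lastEntry p s _) ?_
    (integrableOn_const (volume_bridgeSet_lt_top p).ne) (ae_of_all _ fun _ => by fun_prop)
  filter_upwards [Metric.ball_mem_nhds s₀ one_pos] with s hs
  refine (ae_restrict_iff' (measurableSet_bridgeSet p)).2 (ae_of_all _ fun z hz => ?_)
  have habs : |s| ≤ |s₀| + 1 := by
    have h := abs_sub_abs_le_abs_sub s s₀
    have hlt : |s - s₀| < 1 := hs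
    linarith
  exact (norm_exp_mul_lastEntry_le s hz).trans (Real.exp_le_exp.2 (by gcongr))

theorem lastDensity_nonneg (p : ℕ) {s : ℝ} (hs : 0 ≤ s) : 0 ≤ lastDensity p s := by
  have hl := l_pos p
  have : 0 ≤ ∫ z in bridgeSet p, Real.exp (s * lastEntry z) :=
    integral_nonneg fun _ => (Real.exp_pos _).le
  unfold lastDensity
  positivity

theorem ofReal_lastDensity (p : ℕ) {s : ℝ} (hs : 0 ≤ s) :
    ENNReal.ofReal (lastDensity p s) = ENNReal.ofReal (l (p + 1) * s ^ p) *
      ∫⁻ z in bridgeSet p, ENNReal.ofReal (Real.exp (s * lastEntry z - (p + 1) * s)) := by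
  rw [lastDensity, mul_assoc (l (p + 1) * s ^ p),
    ENNReal.ofReal_mul (mul_nonneg (l_pos p).le (pow_nonneg hs p)),
    ← integral_const_mul, ofReal_integral_eq_lintegral_ofReal
      ((integrableOn_exp_mul_lastEntry p s).const_mul _) (ae_of_all _ fun _ => by positivity)]
  simp only [← Real.exp_add, neg_add_eq_sub]

section FirstMinimum

variable {Ω : Type*} [MeasurableSpace Ω] {P : Measure Ω} [IsProbabilityMeasure P] {X : ℕ → Ω → ℝ}

theorem measure_firstMin_succ (hlaw : ∀ i, HasLaw (X i) (expMeasure 1) P) (hindep : iIndepFun X P)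
    (p m : ℕ) (t : ℝ) :
    P (firstMin X (p + 1 + (m + 1)) (p + 1) t) = ∫⁻ s in Set.Ioo 0 t,
      ENNReal.ofReal (c (p + 1) * s ^ p * Real.exp (-((p + 1) * s)) * Gn P X (m + 1) s) := by
  rw [measure_firstMin hlaw hindep]
  refine setLIntegral_congr_fun measurableSet_Ioo fun s hs => ?_
  have hs0 : 0 ≤ s := hs.1.le
  have hG : 0 ≤ Gn P X (m + 1) s := measureReal_nonneg
  have hconst : ∫⁻ z in bridgeSet p, ENNReal.ofReal (Real.exp (s * lastEntry z - (p + 1) * s)) *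
      survival (m + 1) s (s * lastEntry z) = ∫⁻ _ in bridgeSet p,
        ENNReal.ofReal (Real.exp (-((p + 1) * s)) * Gn P X (m + 1) s) := by
    refine setLIntegral_congr_fun (measurableSet_bridgeSet p) fun z hz => ?_
    rw [survival_eq_exp_mul m hs0 (mul_nonneg hs0 (lastEntry_nonneg hz.1)),
      survival_eq_Gn hlaw hindep, ← mul_assoc, ← ENNReal.ofReal_mul (Real.exp_pos _).le,
      ← ENNReal.ofReal_mul (by positivity), ← Real.exp_add]
    ring_nf
  have hl := (l_pos p).le
  have hvol : volume (bridgeSet p) = ENNReal.ofReal (volume.real (bridgeSet p)) :=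
    (ENNReal.ofReal_toReal (volume_bridgeSet_lt_top p).ne).symm
  rw [hconst, setLIntegral_const, c_succ, hvol, ← ENNReal.ofReal_mul (by positivity),
    ← ENNReal.ofReal_mul (by positivity)]
  ring_nf

theorem measure_firstMin_last (hlaw : ∀ i, HasLaw (X i) (expMeasure 1) P)
    (hindep : iIndepFun X P) (p : ℕ) (t : ℝ) :
    P (firstMin X (p + 1) (p + 1) t) = ∫⁻ s in Set.Ioo 0 t, ENNReal.ofReal (lastDensity p s) := by
  refine (measure_firstMin hlaw hindep p 0 t).trans ?_
  refine setLIntegral_congr_fun measurableSet_Ioo fun s hs => ?_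
  simp only [ofReal_lastDensity p hs.1.le, survival_zero, mul_one]

end FirstMinimum

theorem aemeasurable_Y {Ω : Type*} [MeasurableSpace Ω] {P : Measure Ω} {X : ℕ → Ω → ℝ}
    (hX : ∀ i, AEMeasurable (X i) P) (k : ℕ) : AEMeasurable (Y X k) P := by
  unfold Y S
  fun_prop

theorem nullMeasurableSet_firstMin {Ω : Type*} [MeasurableSpace Ω] {P : Measure Ω}
    {X : ℕ → Ω → ℝ} (hX : ∀ i, AEMeasurable (X i) P) (n k : ℕ) (t : ℝ) :
    NullMeasurableSet (firstMin X n k t) P := by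
  have hbelow := nullMeasurableSet_lt (aemeasurable_Y hX k) (aemeasurable_const (b := t))
  have hbefore : NullMeasurableSet {ω | ∀ j ∈ Finset.Ico 1 k, Y X k ω < Y X j ω} P := by
    simp only [Set.ofPred_forall]
    exact .biInter (Set.to_countable _) fun j _ =>
      nullMeasurableSet_lt (aemeasurable_Y hX k) (aemeasurable_Y hX j)
  have hafter : NullMeasurableSet {ω | ∀ j ∈ Finset.Ioc k n, Y X k ω ≤ Y X j ω} P := by
    simp only [Set.ofPred_forall]
    exact .biInter (Set.to_countable _) fun j _ =>
      nullMeasurableSet_le (aemeasurable_Y hX k) (aemeasurable_Y hX j)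
  exact hbelow.inter (hbefore.inter hafter)

theorem pairwiseDisjoint_firstMin {Ω : Type*} (X : ℕ → Ω → ℝ) (n : ℕ) (t : ℝ) :
    (Finset.range n : Set ℕ).PairwiseDisjoint fun p => firstMin X n (p + 1) t := by
  intro p hp q hq hne
  wlog hpq : p < q generalizing p q
  · exact (this hq hp hne.symm (by omega)).symm
  rw [Function.onFun, Set.disjoint_left]
  rintro ω ⟨-, -, hle⟩ ⟨-, hlt, -⟩
  have hq' : q < n := by simpa using hq
  exact (hle (q + 1) (by rw [Finset.mem_Ioc]; omega)).not_gt
    (hlt (p + 1) (by rw [Finset.mem_Ico]; omega))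

theorem exists_mem_firstMin {Ω : Type*} {X : ℕ → Ω → ℝ} {n k : ℕ} {t : ℝ} {ω : Ω}
    (hk : k ∈ Finset.Icc 1 n) (hlt : Y X k ω < t) : ∃ p < n, ω ∈ firstMin X n (p + 1) t := by
  classical
  have hex : ∃ i, i ∈ Finset.Icc 1 n ∧ ∀ j ∈ Finset.Icc 1 n, Y X i ω ≤ Y X j ω :=
    Finset.exists_min_image _ (fun j => Y X j ω) ⟨k, hk⟩
  obtain ⟨hmem, hmin⟩ := Nat.find_spec hex
  have hfirst (j : ℕ) (hj : j < Nat.find hex) := Nat.find_min hex hj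
  set r := Nat.find hex
  obtain ⟨h1r, hrn⟩ := Finset.mem_Icc.1 hmem
  refine ⟨r - 1, by omega, ?_⟩
  rw [Nat.sub_add_cancel h1r]
  refine ⟨(hmin k hk).trans_lt hlt, fun j hj => ?_, fun j hj => ?_⟩
  · obtain ⟨h1j, hjr⟩ := Finset.mem_Ico.1 hj
    by_contra! hcon
    exact hfirst j hjr ⟨Finset.mem_Icc.2 ⟨h1j, by omega⟩, fun i hi => hcon.trans (hmin i hi)⟩
  · obtain ⟨hrj, hjn⟩ := Finset.mem_Ioc.1 hj
    exact hmin j (Finset.mem_Icc.2 ⟨by omega, hjn⟩)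

theorem compl_setOf_le_Y {Ω : Type*} (X : ℕ → Ω → ℝ) (n : ℕ) (t : ℝ) :
    {ω | ∀ k ∈ Finset.Icc 1 n, t ≤ Y X k ω}ᶜ =
      ⋃ p ∈ Finset.range n, firstMin X n (p + 1) t := by
  ext ω
  simp only [Set.mem_compl_iff, Set.mem_ofPred_eq, Set.mem_iUnion, Finset.mem_range, exists_prop,
    not_forall, not_le]
  exact ⟨fun ⟨k, hk, hlt⟩ => exists_mem_firstMin hk hlt,
    fun ⟨p, hp, hlt, _⟩ => ⟨p + 1, by rw [Finset.mem_Icc]; omega, hlt⟩⟩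

theorem Gn_eq_one_sub_sum {Ω : Type*} [MeasurableSpace Ω] {P : Measure Ω} [IsProbabilityMeasure P]
    {X : ℕ → Ω → ℝ} (hX : ∀ i, AEMeasurable (X i) P) (n : ℕ) (t : ℝ) :
    Gn P X n t = 1 - ∑ p ∈ Finset.range n, P.real (firstMin X n (p + 1) t) := by
  have hmeas (p : ℕ) := nullMeasurableSet_firstMin hX n (p + 1) t
  have hcompl : NullMeasurableSet {ω | ∀ k ∈ Finset.Icc 1 n, t ≤ Y X k ω}ᶜ P := by
    rw [compl_setOf_le_Y]
    exact .biUnion (Set.to_countable _) fun p _ => hmeas p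
  have hunion : P.real {ω | ∀ k ∈ Finset.Icc 1 n, t ≤ Y X k ω}ᶜ =
      ∑ p ∈ Finset.range n, P.real (firstMin X n (p + 1) t) := by
    rw [compl_setOf_le_Y, measureReal_biUnion_finset₀
      (pairwiseDisjoint_firstMin X n t).aedisjoint fun p _ => hmeas p]
  rw [Gn, setOf_le_iInf_Y, ← hunion, ← probReal_compl_eq_one_sub₀ hcompl, compl_compl]

/-! ### The lower tail of the normalized areas -/

theorem mgf_id_expMeasure {r a : ℝ} (hr : 0 < r) (ha : a < r) :
    mgf id (expMeasure r) a = r / (r - a) := by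
  have hpdf (x : ℝ) : (exponentialPDF r x).toReal • Real.exp (a * x) =
      (Set.Ici 0).indicator (fun x => r * Real.exp ((a - r) * x)) x := by
    rcases lt_or_ge x 0 with hx | hx
    · rw [exponentialPDF_of_neg hx, Set.indicator_of_notMem (by simpa using hx)]
      simp
    · rw [exponentialPDF_of_nonneg hx, Set.indicator_of_mem (by simpa using hx),
        ENNReal.toReal_ofReal (by positivity), smul_eq_mul, mul_assoc, ← Real.exp_add]
      ring_nf
  calc mgf id (expMeasure r) a = ∫ x, (exponentialPDF r x).toReal • Real.exp (a * x) :=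
        integral_withDensity_eq_integral_toReal_smul
          (measurable_exponentialPDFReal r).ennreal_ofReal
          (ae_of_all _ fun _ => ENNReal.ofReal_lt_top) _
    _ = ∫ x in Set.Ioi 0, r * Real.exp ((a - r) * x) := by
        simp only [hpdf]
        rw [integral_indicator measurableSet_Ici, integral_Ici_eq_integral_Ioi]
    _ = r / (r - a) := by
        rw [integral_const_mul, integral_exp_mul_Ioi (sub_neg.2 ha), mul_zero, Real.exp_zero,
          ← neg_sub r a, div_neg, neg_div, neg_neg, mul_one_div]

theorem inv_one_add_le_exp {x : ℝ} (hx : 0 ≤ x) : (1 + x)⁻¹ ≤ Real.exp (-(x - x ^ 2)) := by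
  have hx1 : 0 < 1 + x := by positivity
  calc (1 + x)⁻¹ = -(x / (1 + x)) + 1 := by field_simp; ring
    _ ≤ Real.exp (-(x / (1 + x))) := Real.add_one_le_exp _
    _ ≤ Real.exp (-(x - x ^ 2)) := by
      rw [Real.exp_le_exp, neg_le_neg_iff, le_div_iff₀ hx1]
      nlinarith [pow_nonneg hx 3]

section LowerTail

variable {Ω : Type*} [MeasurableSpace Ω] {P : Measure Ω} {X : ℕ → Ω → ℝ}

theorem mgf_area_past (hlaw : ∀ i, HasLaw (X i) (expMeasure 1) P) (hindep : iIndepFun X P)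
    (n : ℕ) {a : ℝ} (ha : 0 ≤ a) :
    mgf (fun ω => area (past X n ω) n) P (-a) = ∏ i : Fin n, (1 + a * (n - (i : ℕ) : ℕ))⁻¹ := by
  have hscaled : iIndepFun (fun (i : Fin n) ω => ((n - (i : ℕ) : ℕ) : ℝ) * X i ω) P :=
    (hindep.precomp Fin.val_injective).comp (fun i : Fin n => (((n - (i : ℕ) : ℕ) : ℝ) * ·))
      fun i => measurable_const_mul _
  have hsum : (fun ω => area (past X n ω) n) =
      ∑ i : Fin n, fun ω => ((n - (i : ℕ) : ℕ) : ℝ) * X i ω := by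
    ext ω
    simp only [area, past, Finset.sum_apply]
  rw [hsum, hscaled.mgf_sum₀ (fun i => (hlaw i).aemeasurable.const_mul _) Finset.univ]
  refine Finset.prod_congr rfl fun i _ => ?_
  have hweight : 0 ≤ a * ((n - (i : ℕ) : ℕ) : ℝ) := by positivity
  rw [mgf_const_mul, ← mgf_id_map (hlaw i).aemeasurable, (hlaw i).map_eq,
    mgf_id_expMeasure one_pos (by linarith), one_div]
  ring_nf

theorem mgf_area_past_le (hlaw : ∀ i, HasLaw (X i) (expMeasure 1) P) (hindep : iIndepFun X P)
    {n : ℕ} (hn : 1 ≤ n) {δ : ℝ} (hδ : 0 ≤ δ) :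
    mgf (fun ω => area (past X n ω) n) P (-(δ / n)) ≤
      Real.exp (-(δ / n * (1 - δ) * l n)) := by
  have hn0 : (0 : ℝ) < n := by exact_mod_cast hn
  have hfactor (i : Fin n) : (1 + δ / n * (n - (i : ℕ) : ℕ))⁻¹ ≤
      Real.exp (-(δ / n * (1 - δ) * (n - (i : ℕ) : ℕ))) := by
    set x : ℝ := δ / n * (n - (i : ℕ) : ℕ) with hx
    have hx0 : 0 ≤ x := by positivity
    have hxδ : x ≤ δ := by
      have hle : ((n - (i : ℕ) : ℕ) : ℝ) ≤ n := by exact_mod_cast Nat.sub_le _ _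
      calc x ≤ δ / n * n := by rw [hx]; gcongr
        _ = δ := div_mul_cancel₀ _ hn0.ne'
    refine (inv_one_add_le_exp hx0).trans (Real.exp_le_exp.2 (neg_le_neg ?_))
    calc δ / n * (1 - δ) * (n - (i : ℕ) : ℕ) = x * (1 - δ) := by rw [hx]; ring
      _ ≤ x * (1 - x) := by gcongr
      _ = x - x ^ 2 := by ring
  have hweights : ∑ i : Fin n, ((n - (i : ℕ) : ℕ) : ℝ) = l n := by
    simpa [area] using area_one (le_refl n)
  calc mgf (fun ω => area (past X n ω) n) P (-(δ / n))
      = ∏ i : Fin n, (1 + δ / n * (n - (i : ℕ) : ℕ))⁻¹ :=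
        mgf_area_past hlaw hindep n (by positivity)
    _ ≤ ∏ i : Fin n, Real.exp (-(δ / n * (1 - δ) * (n - (i : ℕ) : ℕ))) :=
        Finset.prod_le_prod (fun i _ => by positivity) fun i _ => hfactor i
    _ = Real.exp (-(δ / n * (1 - δ) * l n)) := by
        rw [← Real.exp_sum, Finset.sum_neg_distrib, ← Finset.mul_sum, hweights]

theorem measureReal_Y_le [IsProbabilityMeasure P] (hlaw : ∀ i, HasLaw (X i) (expMeasure 1) P)
    (hindep : iIndepFun X P) {n : ℕ} (hn : 1 ≤ n) {r : ℝ} (hr : r ≤ 1) :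
    P.real {ω | Y X n ω ≤ r} ≤ Real.exp (-((1 - r) ^ 2 / 8 * (n + 1))) := by
  have : (0 : ℝ) < n := by exact_mod_cast hn
  have hl : 0 < l n := by unfold l; positivity
  set δ := (1 - r) / 2 with hδ
  have hδ0 : 0 ≤ δ := by linarith
  have hint : Integrable (fun ω => Real.exp (-(δ / n) * area (past X n ω) n)) P := by
    by_contra hnot
    have hpos : 0 < ∏ i : Fin n, (1 + δ / n * (n - (i : ℕ) : ℕ))⁻¹ :=
      Finset.prod_pos fun i _ => by positivity
    exact hpos.ne' ((mgf_area_past hlaw hindep n (by positivity)).symm.trans (mgf_undef hnot))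
  have hevent : {ω | Y X n ω ≤ r} = {ω | area (past X n ω) n ≤ r * l n} := by
    ext ω
    simp only [Set.mem_ofPred_eq, Y_eq_area_div (le_refl n), div_le_iff₀ hl]
  calc P.real {ω | Y X n ω ≤ r}
      ≤ Real.exp (-(-(δ / n)) * (r * l n)) * mgf (fun ω => area (past X n ω) n) P (-(δ / n)) :=
        hevent ▸ measure_le_le_exp_mul_mgf _ (neg_nonpos.2 (by positivity)) hint
    _ ≤ Real.exp (-(-(δ / n)) * (r * l n)) * Real.exp (-(δ / n * (1 - δ) * l n)) := by
        gcongr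
        exact mgf_area_past_le hlaw hindep hn hδ0
    _ = Real.exp (-((1 - r) ^ 2 / 8 * (n + 1))) := by
        rw [← Real.exp_add, hδ, l]
        congr 1
        field_simp
        ring

theorem measure_Y_le_eq_lintegral (hlaw : ∀ i, HasLaw (X i) (expMeasure 1) P)
    (hindep : iIndepFun X P) (p : ℕ) (r : ℝ) :
    P {ω | Y X (p + 1) ω ≤ r} =
      ∫⁻ x, {x : Fin (p + 1) → ℝ | 0 ≤ x ∧ area x (p + 1) ≤ r * l (p + 1)}.indicator
        (fun x => ENNReal.ofReal (Real.exp (-∑ i, x i))) x := by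
  set E : Set (Fin (p + 1) → ℝ) := {x | area x (p + 1) ≤ r * l (p + 1)} with hE
  have hmeas : MeasurableSet E := measurableSet_le (continuous_area _).measurable measurable_const
  have hevent : {ω | Y X (p + 1) ω ≤ r} = {ω | past X (p + 1) ω ∈ E} := by
    ext ω
    simp only [hE, Set.mem_ofPred_eq, Y_eq_area_div le_rfl, div_le_iff₀ (l_pos p)]
  rw [hevent, (hasLaw_past hlaw hindep (p + 1)).measure_eq (p := (· ∈ E)) hmeas]
  change stdExp (p + 1) E = _
  rw [← lintegral_indicator_one hmeas, lintegral_stdExp (measurable_one.indicator hmeas),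
    ← lintegral_indicator measurableSet_Ici]
  refine lintegral_congr fun x => ?_
  by_cases h1 : 0 ≤ x <;> by_cases h2 : area x (p + 1) ≤ r * l (p + 1) <;>
    simp [hE, h1, h2]

theorem bridge_add_single_add_mem {p : ℕ} {s θ : ℝ} {u : Fin p → ℝ} (hu : 0 ≤ bridge u + s • 1)
    (hθ : θ ∈ Set.Icc (0 : ℝ) 1) :
    bridge u + θ • Pi.single 0 1 + s • 1 ∈
      {x : Fin (p + 1) → ℝ | 0 ≤ x ∧ area x (p + 1) ≤ (s + 2 / (p + 2)) * l (p + 1)} := by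
  constructor
  · have hsingle : 0 ≤ θ • (Pi.single 0 1 : Fin (p + 1) → ℝ) :=
      smul_nonneg hθ.1 (Pi.single_nonneg.2 zero_le_one)
    rw [add_right_comm]
    exact add_nonneg hu hsingle
  · have hl : (s + 2 / ((p : ℝ) + 2)) * l (p + 1) = (p + 1) + s * l (p + 1) := by
      rw [l]; push_cast; field_simp; ring
    rw [area_add, area_add, area_bridge_last, area_smul, area_smul, area_single, area_one le_rfl,
      hl, zero_add]
    push_cast
    gcongr
    exact mul_le_of_le_one_left (by positivity) hθ.2

theorem sum_bridge_add_single_add_le {p : ℕ} (s : ℝ) {θ : ℝ} (u : Fin p → ℝ) (hθ : θ ≤ 1) :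
    ∑ i, (bridge u + θ • Pi.single 0 1 + s • 1 : Fin (p + 1) → ℝ) i ≤
      (p + 1) * s + 1 - lastEntry u := by
  simp only [Pi.add_apply, Pi.smul_apply, Pi.one_apply, smul_eq_mul, Finset.sum_add_distrib,
    sum_bridge, ← Finset.mul_sum, Finset.sum_pi_single', Finset.mem_univ, if_true,
    Finset.sum_const, Finset.card_univ, Fintype.card_fin, nsmul_eq_mul]
  push_cast
  linarith

theorem lintegral_bridgeSet_le_measure_Y_le (hlaw : ∀ i, HasLaw (X i) (expMeasure 1) P)
    (hindep : iIndepFun X P) (p : ℕ) {s : ℝ} (hs : 0 < s) :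
    ENNReal.ofReal ((p + 1) * s ^ p) * ∫⁻ z in bridgeSet p,
        ENNReal.ofReal (Real.exp (s * lastEntry z - (p + 1) * s)) ≤
      ENNReal.ofReal (Real.exp 1) * P {ω | Y X (p + 1) ω ≤ s + 2 / (p + 2)} := by
  set F : (Fin p → ℝ) → ℝ≥0∞ := fun u =>
    ENNReal.ofReal (Real.exp (lastEntry u - (p + 1) * s)) with hF
  set E : Set (Fin (p + 1) → ℝ) :=
    {x | 0 ≤ x ∧ area x (p + 1) ≤ (s + 2 / (p + 2)) * l (p + 1)}
  set H : (Fin (p + 1) → ℝ) → ℝ≥0∞ := fun x =>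
    ENNReal.ofReal (Real.exp 1) * E.indicator (fun x => ENNReal.ofReal (Real.exp (-∑ i, x i))) x
    with hH
  have hEmeas : MeasurableSet E :=
    measurableSet_Ici.inter (measurableSet_le (continuous_area _).measurable measurable_const)
  have hexp : Measurable (E.indicator fun x : Fin (p + 1) → ℝ =>
      ENNReal.ofReal (Real.exp (-∑ i, x i))) := Measurable.indicator (by fun_prop) hEmeas
  have hle (u : Fin p → ℝ) (θ : ℝ) (hθ : θ ∈ Set.Icc (0 : ℝ) 1) :
      {u : Fin p → ℝ | 0 ≤ u ∧ 0 ≤ bridge u + s • 1}.indicator F u ≤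
        H (bridge u + θ • Pi.single 0 1 + s • 1) := by
    refine Set.indicator_apply_le' (fun hu => ?_) fun _ => zero_le
    have hmem : bridge u + θ • Pi.single 0 1 + s • 1 ∈ E := bridge_add_single_add_mem hu.2 hθ
    simp only [hF, hH, Set.indicator_of_mem hmem]
    rw [← ENNReal.ofReal_mul (Real.exp_pos _).le, ← Real.exp_add]
    gcongr
    linarith [sum_bridge_add_single_add_le s u hθ.2]
  calc ENNReal.ofReal ((p + 1) * s ^ p) * ∫⁻ z in bridgeSet p,
        ENNReal.ofReal (Real.exp (s * lastEntry z - (p + 1) * s))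
      = ENNReal.ofReal (p + 1) *
          ∫⁻ u, {u : Fin p → ℝ | 0 ≤ u ∧ 0 ≤ bridge u + s • 1}.indicator F u := by
        rw [lintegral_indicator (measurableSet_slice p s), setLIntegral_slice hs, ← mul_assoc,
          ← ENNReal.ofReal_mul (by positivity)]
        simp only [hF, lastEntry_smul]
    _ ≤ ∫⁻ x, H x := slice_le_lintegral (hexp.const_mul _) s hle
    _ = ENNReal.ofReal (Real.exp 1) * P {ω | Y X (p + 1) ω ≤ s + 2 / (p + 2)} := by
        rw [measure_Y_le_eq_lintegral hlaw hindep, lintegral_const_mul _ hexp]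

theorem lastDensity_le [IsFiniteMeasure P] (hlaw : ∀ i, HasLaw (X i) (expMeasure 1) P)
    (hindep : iIndepFun X P) {p : ℕ} (hp : p ≠ 0) {s : ℝ} (hs : 0 ≤ s) :
    lastDensity p s ≤ Real.exp 1 * ((p + 2) / 2) *
      P.real {ω | Y X (p + 1) ω ≤ s + 2 / (p + 2)} := by
  rcases hs.eq_or_lt with rfl | hs
  · rw [lastDensity, zero_pow hp, mul_zero, zero_mul, zero_mul]
    positivity
  have hl : l (p + 1) * s ^ p = (p + 2) / 2 * ((p + 1) * s ^ p) := by
    rw [l]; push_cast; ring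
  have hle : ENNReal.ofReal (lastDensity p s) ≤ ENNReal.ofReal (Real.exp 1 * ((p + 2) / 2)) *
      P {ω | Y X (p + 1) ω ≤ s + 2 / (p + 2)} := by
    rw [ofReal_lastDensity p hs.le, hl, mul_comm (Real.exp 1),
      ENNReal.ofReal_mul (p := ((p : ℝ) + 2) / 2) (by positivity), mul_assoc,
      ENNReal.ofReal_mul (p := ((p : ℝ) + 2) / 2) (by positivity), mul_assoc]
    exact mul_le_mul_right (lintegral_bridgeSet_le_measure_Y_le hlaw hindep p hs) _
  rwa [← ofReal_measureReal, ← ENNReal.ofReal_mul (by positivity),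
    ENNReal.ofReal_le_ofReal_iff (by positivity)] at hle

end LowerTail

/-! ### Integrals, derivatives and uniform limits -/

theorem toReal_setLIntegral_Ioo {f : ℝ → ℝ} {a b : ℝ} (hab : a ≤ b)
    (hf : IntervalIntegrable f volume a b) (h0 : ∀ s ∈ Set.Ioo a b, 0 ≤ f s) :
    (∫⁻ s in Set.Ioo a b, ENNReal.ofReal (f s)).toReal = ∫ s in a..b, f s := by
  rw [intervalIntegrable_iff_integrableOn_Ioo_of_le hab] at hf
  rw [intervalIntegral.integral_of_le hab, integral_Ioc_eq_integral_Ioo,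
    integral_eq_lintegral_of_nonneg_ae
      ((ae_restrict_iff' measurableSet_Ioo).2 (ae_of_all _ h0)) hf.aestronglyMeasurable]

theorem hasDerivWithinAt_of_eq_integral {f g : ℝ → ℝ} {a b y t : ℝ}
    (hf : ContinuousOn f (Set.Icc a b)) (hg : ∀ t ∈ Set.Icc a b, g t = y + ∫ s in a..t, f s)
    (ht : t ∈ Set.Icc a b) : HasDerivWithinAt g (f t) (Set.Icc a b) t := by
  have : Fact (t ∈ Set.Icc a b) := ⟨ht⟩
  have hint : IntervalIntegrable f volume a t :=
    (hf.mono (Set.Icc_subset_Icc_right ht.2)).intervalIntegrable_of_Icc ht.1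
  exact ((intervalIntegral.integral_hasDerivWithinAt_right hint
    (hf.stronglyMeasurableAtFilter_nhdsWithin measurableSet_Icc t) (hf t ht)).const_add y).congr
      hg (hg t ht)

theorem contDiffOn_one_of_hasDerivWithinAt {f g : ℝ → ℝ} {s : Set ℝ} (hs : UniqueDiffOn ℝ s)
    (hf : ContinuousOn f s) (hg : ∀ t ∈ s, HasDerivWithinAt g (f t) s t) : ContDiffOn ℝ 1 g s := by
  rw [contDiffOn_one_iff_derivWithin hs]
  exact ⟨fun t ht => (hg t ht).differentiableWithinAt,
    hf.congr fun t ht => (hg t ht).derivWithin (hs t ht)⟩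

theorem hasSum_mul_sub_ite_lt {R : Type*} [Ring R] [TopologicalSpace R] [IsTopologicalRing R]
    {a : ℕ → R} (ha : Summable a) (b : ℕ → R) (y : R) (N : ℕ) :
    HasSum (fun p => a p * (y - if p < N then b p else 0))
      ((∑' p, a p) * y - ∑ p ∈ Finset.range N, a p * b p) := by
  have hfin : HasSum (fun p => if p < N then a p * b p else 0)
      (∑ p ∈ Finset.range N, if p < N then a p * b p else 0) :=
    hasSum_sum_of_ne_finset_zero fun p hp => if_neg (Finset.mem_range.not.1 hp)
  rw [Finset.sum_congr rfl fun p hp => if_pos (Finset.mem_range.1 hp)] at hfin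
  simpa only [mul_sub, mul_ite, mul_zero] using (ha.hasSum.mul_right y).sub hfin

theorem tendstoUniformlyOn_sum_mul_sub {α R : Type*} [NormedRing R] [CompleteSpace R]
    {a f : ℕ → α → R} {g : α → R} {s : Set α} {M : ℕ → ℝ} {C : ℝ} (hM : Summable M)
    (ha : ∀ p, ∀ t ∈ s, ‖a p t‖ ≤ M p) (hf : ∀ n, ∀ t ∈ s, ‖f n t‖ ≤ C)
    (h : TendstoUniformlyOn f g atTop s) :
    TendstoUniformlyOn (fun N t => ∑ p ∈ Finset.range N, a p t * f (N - p) t)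
      (fun t => (∑' p, a p t) * g t) atTop s := by
  have hg (t : α) (ht : t ∈ s) : ‖g t‖ ≤ C :=
    le_of_tendsto (h.tendsto_at ht).norm (Eventually.of_forall fun n => hf n t ht)
  have hs : ∀ᶠ q : ℕ × α in atTop ×ˢ 𝓟 s, q.2 ∈ s :=
    tendsto_snd.eventually (mem_principal_self s)
  let d (p : ℕ) (q : ℕ × α) : R := g q.2 - if p < q.1 then f (q.1 - p) q.2 else 0
  have hd : ∀ᶠ q in atTop ×ˢ 𝓟 s, ∀ p, ‖a p q.2 * d p q‖ ≤ M p * (C + C) := by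
    filter_upwards [hs] with q hq p
    have hC : 0 ≤ C := (norm_nonneg _).trans (hg q.2 hq)
    have hdC : ‖d p q‖ ≤ C + C := (norm_sub_le _ _).trans <| add_le_add (hg q.2 hq) <| by
      split_ifs
      exacts [hf _ _ hq, norm_zero.trans_le hC]
    exact (norm_mul_le _ _).trans
      (mul_le_mul (ha p _ hq) hdC (norm_nonneg _) ((norm_nonneg _).trans (ha p _ hq)))
  have hlim (p : ℕ) : Tendsto (fun q => a p q.2 * d p q) (atTop ×ˢ 𝓟 s) (𝓝 0) := by
    have hdist : Tendsto (fun q : ℕ × α => dist (g q.2) (f (q.1 - p) q.2)) (atTop ×ˢ 𝓟 s) (𝓝 0) :=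
      tendsto_uniformity_iff_dist_tendsto_zero.1 <| tendstoUniformlyOn_iff_tendsto.1 fun u hu =>
        (tendsto_sub_atTop_nat p).eventually (h u hu)
    refine squeeze_zero_norm' ?_ (by simpa only [mul_zero] using hdist.const_mul (M p))
    filter_upwards [hs, tendsto_fst.eventually (eventually_gt_atTop p)] with q hq hpq
    simp only [d, if_pos hpq, dist_eq_norm]
    exact (norm_mul_le _ _).trans (mul_le_mul_of_nonneg_right (ha p _ hq) (norm_nonneg _))
  have htsum : Tendsto (fun q : ℕ × α => ∑' p, a p q.2 * d p q) (atTop ×ˢ 𝓟 s) (𝓝 0) := by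
    simpa only [tsum_zero] using
      tendsto_tsum_of_dominated_convergence (hM.mul_right (C + C)) hlim hd
  rw [tendstoUniformlyOn_iff_tendsto, tendsto_uniformity_iff_dist_tendsto_zero]
  refine (tendsto_congr' ?_).2 (tendsto_zero_iff_norm_tendsto_zero.1 htsum)
  filter_upwards [hs] with q hq
  have hsum : Summable fun p => a p q.2 := .of_norm_bounded hM fun p => ha p _ hq
  rw [dist_eq_norm, ← (hasSum_mul_sub_ite_lt hsum (fun p => f (q.1 - p) q.2) _ _).tsum_eq]

/-! ### The derivatives of `G_n` -/

section Calculus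

variable {Ω : Type*} [MeasurableSpace Ω] {P : Measure Ω} {X : ℕ → Ω → ℝ}

/-- The density on `(0, ∞)` of `min_{1 ≤ k ≤ N + 1} Y_k`, that is `-G_{N + 1}'`: the `p`th summand
is the contribution of `Y_{p + 1}` being the minimum, and `lastDensity N` that of `Y_{N + 1}`. -/
def minDensity {Ω : Type*} [MeasurableSpace Ω] (P : Measure Ω) (X : ℕ → Ω → ℝ) (N : ℕ) (s : ℝ) :
    ℝ :=
  ∑ p ∈ Finset.range N, Real.exp (-s) * (c (p + 1) * (s * Real.exp (-s)) ^ p) * Gn P X (N - p) s +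
    lastDensity N s

theorem Gn_antitone [IsFiniteMeasure P] (n : ℕ) : Antitone (Gn P X n) := fun _ _ hst =>
  measureReal_mono fun _ hω => (EReal.coe_le_coe hst).trans hω

theorem intervalIntegrable_mul_Gn [IsFiniteMeasure P] {f : ℝ → ℝ} (hf : Continuous f) (n : ℕ)
    (a b : ℝ) : IntervalIntegrable (fun s => f s * Gn P X n s) volume a b :=
  (Gn_antitone n).intervalIntegrable.continuousOn_mul hf.continuousOn

theorem intervalIntegrable_sum_mul_Gn [IsFiniteMeasure P] (N : ℕ) (a b : ℝ) :
    IntervalIntegrable (fun s => ∑ p ∈ Finset.range N,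
      Real.exp (-s) * (c (p + 1) * (s * Real.exp (-s)) ^ p) * Gn P X (N - p) s) volume a b := by
  simpa only [Finset.sum_fn] using IntervalIntegrable.sum (Finset.range N) fun p _ =>
    intervalIntegrable_mul_Gn (P := P) (X := X)
      (f := fun s => Real.exp (-s) * (c (p + 1) * (s * Real.exp (-s)) ^ p)) (by fun_prop)
      (N - p) a b

theorem intervalIntegrable_minDensity [IsFiniteMeasure P] (N : ℕ) (a b : ℝ) :
    IntervalIntegrable (minDensity P X N) volume a b :=
  (intervalIntegrable_sum_mul_Gn N a b).add ((continuous_lastDensity N).intervalIntegrable a b)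

theorem measureReal_firstMin_of_lt [IsProbabilityMeasure P]
    (hlaw : ∀ i, HasLaw (X i) (expMeasure 1) P) (hindep : iIndepFun X P) {p N : ℕ} (hp : p < N)
    {t : ℝ} (ht : 0 ≤ t) :
    P.real (firstMin X (N + 1) (p + 1) t) =
      ∫ s in 0..t, Real.exp (-s) * (c (p + 1) * (s * Real.exp (-s)) ^ p) * Gn P X (N - p) s := by
  obtain ⟨m, rfl⟩ := Nat.exists_eq_add_of_lt hp
  have hexp (s : ℝ) : Real.exp (-s) * (c (p + 1) * (s * Real.exp (-s)) ^ p) =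
      c (p + 1) * s ^ p * Real.exp (-((p + 1) * s)) := by
    rw [mul_pow, ← Real.exp_nat_mul, show -((p + 1) * s) = p * -s + -s by ring, Real.exp_add]
    ring
  simp only [hexp, show p + m + 1 - p = m + 1 by omega]
  rw [← toReal_setLIntegral_Ioo ht (intervalIntegrable_mul_Gn (by fun_prop) _ _ _) fun s hs => ?_,
    ← measure_firstMin_succ hlaw hindep, Measure.real, show p + 1 + (m + 1) = p + m + 1 + 1 by ring]
  have hc := (c_pos p).le
  have hs0 := hs.1.le
  exact mul_nonneg (by positivity) measureReal_nonneg

theorem measureReal_firstMin_self [IsProbabilityMeasure P]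
    (hlaw : ∀ i, HasLaw (X i) (expMeasure 1) P) (hindep : iIndepFun X P) (N : ℕ) {t : ℝ}
    (ht : 0 ≤ t) :
    P.real (firstMin X (N + 1) (N + 1) t) = ∫ s in 0..t, lastDensity N s := by
  rw [← toReal_setLIntegral_Ioo ht ((continuous_lastDensity N).intervalIntegrable 0 t)
    fun s hs => lastDensity_nonneg N hs.1.le, ← measure_firstMin_last hlaw hindep, Measure.real]

theorem Gn_succ_eq_one_sub_integral [IsProbabilityMeasure P]
    (hlaw : ∀ i, HasLaw (X i) (expMeasure 1) P) (hindep : iIndepFun X P) (N : ℕ) {t : ℝ}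
    (ht : 0 ≤ t) : Gn P X (N + 1) t = 1 - ∫ s in 0..t, minDensity P X N s := by
  have hsum : ∑ p ∈ Finset.range N, P.real (firstMin X (N + 1) (p + 1) t) =
      ∑ p ∈ Finset.range N, ∫ s in 0..t,
        Real.exp (-s) * (c (p + 1) * (s * Real.exp (-s)) ^ p) * Gn P X (N - p) s :=
    Finset.sum_congr rfl fun p hp =>
      measureReal_firstMin_of_lt hlaw hindep (Finset.mem_range.1 hp) ht
  rw [Gn_eq_one_sub_sum (fun i => (hlaw i).aemeasurable), Finset.sum_range_succ, hsum,
    measureReal_firstMin_self hlaw hindep N ht,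
    ← intervalIntegral.integral_finsetSum fun p _ =>
      intervalIntegrable_mul_Gn (by fun_prop) (N - p) 0 t,
    ← intervalIntegral.integral_add (intervalIntegrable_sum_mul_Gn N 0 t)
      ((continuous_lastDensity N).intervalIntegrable 0 t)]
  rfl

theorem continuousOn_Gn [IsProbabilityMeasure P] (hlaw : ∀ i, HasLaw (X i) (expMeasure 1) P)
    (hindep : iIndepFun X P) : ∀ n, ContinuousOn (Gn P X n) (Set.Ici 0)
  | 0 => by
    have hone : Gn P X 0 = fun _ => 1 := funext fun t => by
      rw [Gn_eq_one_sub_sum fun i => (hlaw i).aemeasurable, Finset.range_zero, Finset.sum_empty,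
        sub_zero]
    exact hone ▸ continuousOn_const
  | N + 1 => ContinuousOn.congr (continuous_const.sub (intervalIntegral.continuous_primitive
      (intervalIntegrable_minDensity N) 0)).continuousOn
      fun _ ht => Gn_succ_eq_one_sub_integral hlaw hindep N ht

theorem continuousOn_minDensity [IsProbabilityMeasure P]
    (hlaw : ∀ i, HasLaw (X i) (expMeasure 1) P) (hindep : iIndepFun X P) (N : ℕ) :
    ContinuousOn (minDensity P X N) (Set.Ici 0) :=
  (continuousOn_finsetSum _ fun p _ => ContinuousOn.mul
    (Continuous.continuousOn (by fun_prop)) (continuousOn_Gn hlaw hindep (N - p))).add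
      (continuous_lastDensity N).continuousOn

theorem hasDerivWithinAt_Gn [IsProbabilityMeasure P] (hlaw : ∀ i, HasLaw (X i) (expMeasure 1) P)
    (hindep : iIndepFun X P) (N : ℕ) {t : ℝ} (ht : 0 ≤ t) :
    HasDerivWithinAt (Gn P X (N + 1)) (-minDensity P X N t) (Set.Ici 0) t := by
  have hderiv := hasDerivWithinAt_of_eq_integral (f := fun s => -minDensity P X N s)
    (g := Gn P X (N + 1)) (y := 1) (b := t + 1)
    ((continuousOn_minDensity hlaw hindep N).neg.mono Set.Icc_subset_Ici_self)
    (fun s hs => by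
      rw [Gn_succ_eq_one_sub_integral hlaw hindep N hs.1, intervalIntegral.integral_neg,
        sub_eq_add_neg])
    (t := t) ⟨ht, by linarith⟩
  exact hderiv.mono_of_mem_nhdsWithin
    (inter_mem_nhdsWithin (Set.Ici 0) (Iic_mem_nhds (lt_add_one t)))

theorem contDiffOn_Gn [IsProbabilityMeasure P] (hlaw : ∀ i, HasLaw (X i) (expMeasure 1) P)
    (hindep : iIndepFun X P) (N : ℕ) : ContDiffOn ℝ 1 (Gn P X (N + 1)) (Set.Ici 0) :=
  contDiffOn_one_of_hasDerivWithinAt (uniqueDiffOn_Ici 0)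
    (continuousOn_minDensity hlaw hindep N).neg
    fun _ ht => hasDerivWithinAt_Gn hlaw hindep N ht

end Calculus

/-! ### The limit `n → ∞` -/

section Limit

variable {Ω : Type*} [MeasurableSpace Ω] {P : Measure Ω} [IsProbabilityMeasure P] {X : ℕ → Ω → ℝ}

theorem G_le_Gn (n : ℕ) (t : ℝ) : G P X t ≤ Gn P X n t :=
  measureReal_mono fun _ hω => le_trans (α := EReal) hω <|
    biInf_mono fun _ hk => (Finset.mem_Icc.1 hk).1

theorem Gn_le_G_add {b t : ℝ} (htb : t ≤ b) (n : ℕ) :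
    Gn P X n t ≤ G P X t + P.real (⋃ k, {ω | Y X (k + n + 1) ω ≤ b}) := by
  refine (measureReal_mono fun ω hω => ?_).trans (measureReal_union_le _ _)
  rw [setOf_le_iInf_Y, Set.mem_ofPred_eq] at hω
  by_cases htail : ∃ k, Y X (k + n + 1) ω ≤ b
  · exact Or.inr (Set.mem_iUnion.2 htail)
  · push Not at htail
    refine Or.inl (le_iInf₂ fun k hk => EReal.coe_le_coe_iff.2 ?_)
    rcases le_or_gt k n with hkn | hkn
    · exact hω k (Finset.mem_Icc.2 ⟨hk, hkn⟩)
    · obtain ⟨j, rfl⟩ := Nat.exists_eq_add_of_lt hkn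
      exact htb.trans (add_comm n j ▸ htail j).le

theorem tsum_measure_Y_le_ne_top (hlaw : ∀ i, HasLaw (X i) (expMeasure 1) P)
    (hindep : iIndepFun X P) {b : ℝ} (hb : b < 1) : ∑' k, P {ω | Y X (k + 1) ω ≤ b} ≠ ∞ := by
  set κ := (1 - b) ^ 2 / 8
  have hκ : 0 < κ := by have := sub_pos.2 hb; positivity
  have hle (k : ℕ) : P {ω | Y X (k + 1) ω ≤ b} ≤ ENNReal.ofReal (Real.exp (-κ) ^ k) := by
    have hexp : -(κ * ((k + 1 : ℕ) + 1)) ≤ k * -κ := by push_cast; nlinarith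
    rw [← ofReal_measureReal, ← Real.exp_nat_mul]
    exact ENNReal.ofReal_le_ofReal
      ((measureReal_Y_le hlaw hindep (by omega) hb.le).trans (Real.exp_le_exp.2 hexp))
  have hgeom : Summable fun k => Real.exp (-κ) ^ k :=
    summable_geometric_of_lt_one (Real.exp_pos _).le (Real.exp_lt_one_iff.2 (neg_lt_zero.2 hκ))
  exact ne_top_of_le_ne_top hgeom.tsum_ofReal_ne_top (ENNReal.tsum_le_tsum hle)

theorem tendsto_measureReal_iUnion_Y_le (hlaw : ∀ i, HasLaw (X i) (expMeasure 1) P)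
    (hindep : iIndepFun X P) {b : ℝ} (hb : b < 1) :
    Tendsto (fun n => P.real (⋃ k, {ω | Y X (k + n + 1) ω ≤ b})) atTop (𝓝 0) :=
  (ENNReal.tendsto_toReal_zero_iff fun _ => measure_ne_top _ _).2 <|
    tendsto_of_tendsto_of_tendsto_of_le_of_le tendsto_const_nhds
      (ENNReal.tendsto_sum_nat_add _ (tsum_measure_Y_le_ne_top hlaw hindep hb))
      (fun _ => zero_le) fun _ => measure_iUnion_le _

theorem tendstoUniformlyOn_Gn (hlaw : ∀ i, HasLaw (X i) (expMeasure 1) P)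
    (hindep : iIndepFun X P) {b : ℝ} (hb : b < 1) :
    TendstoUniformlyOn (Gn P X) (G P X) atTop (Set.Iic b) := by
  refine Metric.tendstoUniformlyOn_iff.2 fun ε hε => ?_
  filter_upwards [(tendsto_measureReal_iUnion_Y_le hlaw hindep hb).eventually_lt_const hε]
    with n hn t ht
  rw [dist_comm, Real.dist_eq, abs_of_nonneg (sub_nonneg.2 (G_le_Gn n t))]
  linarith [Gn_le_G_add (P := P) (X := X) ht n]

theorem lastDensity_le_mul_pow (hlaw : ∀ i, HasLaw (X i) (expMeasure 1) P)
    (hindep : iIndepFun X P) {N : ℕ} (hN : N ≠ 0) {r t : ℝ} (ht : 0 ≤ t) (htr : t + 2 / (N + 2) ≤ r)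
    (hr : r ≤ 1) :
    lastDensity N t ≤
      Real.exp 1 / 2 * ((N + 2 : ℕ) ^ 1 * Real.exp (-((1 - r) ^ 2 / 8)) ^ (N + 2)) :=
  calc lastDensity N t
      ≤ Real.exp 1 * ((N + 2) / 2) * P.real {ω | Y X (N + 1) ω ≤ t + 2 / (N + 2)} :=
        lastDensity_le hlaw hindep hN ht
    _ ≤ Real.exp 1 * ((N + 2) / 2) * P.real {ω | Y X (N + 1) ω ≤ r} := by
        gcongr
        finiteness
    _ ≤ Real.exp 1 * ((N + 2) / 2) * Real.exp (-((1 - r) ^ 2 / 8 * ((N + 1 : ℕ) + 1))) := by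
        gcongr
        exact measureReal_Y_le hlaw hindep (by omega) hr
    _ = Real.exp 1 / 2 * ((N + 2 : ℕ) ^ 1 * Real.exp (-((1 - r) ^ 2 / 8)) ^ (N + 2)) := by
        rw [← Real.exp_nat_mul, show -((1 - r) ^ 2 / 8 * ((N + 1 : ℕ) + 1)) =
          (N + 2 : ℕ) * -((1 - r) ^ 2 / 8) by push_cast; ring]
        push_cast
        ring

theorem tendstoUniformlyOn_lastDensity (hlaw : ∀ i, HasLaw (X i) (expMeasure 1) P)
    (hindep : iIndepFun X P) {b : ℝ} (hb : b < 1) :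
    TendstoUniformlyOn lastDensity 0 atTop (Set.Icc 0 b) := by
  obtain ⟨r, hbr, hr⟩ := exists_between hb
  have hratio : |Real.exp (-((1 - r) ^ 2 / 8))| < 1 := by
    have := sub_pos.2 hr
    rw [abs_of_pos (Real.exp_pos _), Real.exp_lt_one_iff, neg_lt_zero]
    positivity
  have hbound := ((tendsto_add_atTop_iff_nat 2).2
    (tendsto_pow_const_mul_const_pow_of_abs_lt_one 1 hratio)).const_mul (Real.exp 1 / 2)
  rw [mul_zero] at hbound
  have hshift : Tendsto (fun N : ℕ => 2 / ((N : ℝ) + 2)) atTop (𝓝 0) :=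
    (tendsto_atTop_add_const_right _ _ tendsto_natCast_atTop_atTop).const_div_atTop 2
  refine Metric.tendstoUniformlyOn_iff.2 fun ε hε => ?_
  filter_upwards [hbound.eventually_lt_const hε, eventually_ne_atTop 0,
    hshift.eventually_le_const (sub_pos.2 hbr)] with N hNε hN0 hN t ht
  rw [Pi.zero_apply, dist_zero_left, Real.norm_of_nonneg (lastDensity_nonneg N ht.1)]
  exact (lastDensity_le_mul_pow hlaw hindep hN0 ht.1 (by linarith [ht.2]) hr.le).trans_lt hNε

theorem tendstoUniformlyOn_neg_minDensity (hlaw : ∀ i, HasLaw (X i) (expMeasure 1) P)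
    (hindep : iIndepFun X P) {b : ℝ} (hb : b ∈ Set.Ico 0 1) :
    TendstoUniformlyOn (fun N t => -minDensity P X N t) (rhs P X) atTop (Set.Icc 0 b) := by
  have hcoeff (p : ℕ) (t : ℝ) (ht : t ∈ Set.Icc 0 b) :
      ‖Real.exp (-t) * (c (p + 1) * (t * Real.exp (-t)) ^ p)‖ ≤
        c (p + 1) * (b * Real.exp (-b)) ^ p := by
    have hc := (c_pos p).le
    have ht0 := ht.1
    rw [Real.norm_of_nonneg (by positivity)]
    refine (mul_le_of_le_one_left (by positivity)
      (Real.exp_le_one_iff.2 (neg_nonpos.2 ht0))).trans ?_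
    gcongr _ * ?_ ^ p
    exact mul_exp_neg_le ht.2 hb.1 hb.2.le
  have hGn (n : ℕ) (t : ℝ) (_ : t ∈ Set.Icc 0 b) : ‖Gn P X n t‖ ≤ 1 :=
    (Real.norm_of_nonneg measureReal_nonneg).trans_le measureReal_le_one
  have hsum := tendstoUniformlyOn_sum_mul_sub (summable_c_mul_exp hb) hcoeff hGn
    ((tendstoUniformlyOn_Gn hlaw hindep hb.2).mono Set.Icc_subset_Iic_self)
  refine ((hsum.add (tendstoUniformlyOn_lastDensity hlaw hindep hb.2)).neg).congr_right
    fun t _ => ?_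
  simp only [Pi.neg_apply, add_zero, tsum_mul_left, rhs]
  ring

theorem continuousOn_rhs_Icc (hlaw : ∀ i, HasLaw (X i) (expMeasure 1) P) (hindep : iIndepFun X P)
    {b : ℝ} (hb : b ∈ Set.Ico 0 1) : ContinuousOn (rhs P X) (Set.Icc 0 b) :=
  (tendstoUniformlyOn_neg_minDensity hlaw hindep hb).continuousOn <| Frequently.of_forall fun N =>
    (continuousOn_minDensity hlaw hindep N).neg.mono Set.Icc_subset_Ici_self

theorem G_eq_one_add_integral (hlaw : ∀ i, HasLaw (X i) (expMeasure 1) P)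
    (hindep : iIndepFun X P) {t : ℝ} (ht : t ∈ Set.Ico 0 1) :
    G P X t = 1 + ∫ s in 0..t, rhs P X s := by
  have hG : Tendsto (fun N => Gn P X (N + 1) t) atTop (𝓝 (G P X t)) :=
    (tendsto_add_atTop_iff_nat 1).2
      ((tendstoUniformlyOn_Gn hlaw hindep ht.2).tendsto_at Set.self_mem_Iic)
  have hint : Tendsto (fun N => ∫ s in 0..t, -minDensity P X N s) atTop
      (𝓝 (∫ s in 0..t, rhs P X s)) :=
    TendstoUniformlyOn.tendsto_intervalIntegral_of_continuousOn
      (Eventually.of_forall fun N => (continuousOn_minDensity hlaw hindep N).neg.mono <|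
        (Set.uIcc_of_le ht.1).trans_subset Set.Icc_subset_Ici_self)
      ((Set.uIcc_of_le ht.1).symm ▸ tendstoUniformlyOn_neg_minDensity hlaw hindep ht)
  refine tendsto_nhds_unique hG ((hint.const_add 1).congr fun N => ?_)
  rw [Gn_succ_eq_one_sub_integral hlaw hindep N ht.1, intervalIntegral.integral_neg,
    sub_eq_add_neg]

theorem exists_Icc_mem_nhdsWithin_Ico {t : ℝ} (ht : t ∈ Set.Ico (0 : ℝ) 1) :
    ∃ b ∈ Set.Ico (0 : ℝ) 1, t ≤ b ∧ Set.Icc 0 b ∈ 𝓝[Set.Ico 0 1] t := by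
  obtain ⟨b, htb, hb⟩ := exists_between ht.2
  refine ⟨b, ⟨ht.1.trans htb.le, hb⟩, htb.le, ?_⟩
  filter_upwards [self_mem_nhdsWithin, mem_nhdsWithin_of_mem_nhds (Iic_mem_nhds htb)] with s hs hsb
  exact ⟨hs.1, hsb⟩

theorem continuousOn_rhs (hlaw : ∀ i, HasLaw (X i) (expMeasure 1) P) (hindep : iIndepFun X P) :
    ContinuousOn (rhs P X) (Set.Ico 0 1) := fun t ht =>
  have ⟨_, hb, htb, hmem⟩ := exists_Icc_mem_nhdsWithin_Ico ht
  (continuousOn_rhs_Icc hlaw hindep hb t ⟨ht.1, htb⟩).mono_of_mem_nhdsWithin hmem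

theorem hasDerivWithinAt_G (hlaw : ∀ i, HasLaw (X i) (expMeasure 1) P) (hindep : iIndepFun X P)
    {t : ℝ} (ht : t ∈ Set.Ico 0 1) : HasDerivWithinAt (G P X) (rhs P X t) (Set.Ico 0 1) t :=
  have ⟨_, hb, htb, hmem⟩ := exists_Icc_mem_nhdsWithin_Ico ht
  (hasDerivWithinAt_of_eq_integral (continuousOn_rhs_Icc hlaw hindep hb)
    (fun _ hs => G_eq_one_add_integral hlaw hindep ⟨hs.1, hs.2.trans_lt hb.2⟩)
    ⟨ht.1, htb⟩).mono_of_mem_nhdsWithin hmem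

theorem tendstoUniformlyOn_derivWithin_Gn (hlaw : ∀ i, HasLaw (X i) (expMeasure 1) P)
    (hindep : iIndepFun X P) {b : ℝ} (hb : b ∈ Set.Ico 0 1) :
    TendstoUniformlyOn (fun n => derivWithin (Gn P X n) (Set.Ici 0)) (rhs P X) atTop
      (Set.Icc 0 b) := by
  intro u hu
  rw [← map_add_atTop_eq_nat 1, eventually_map]
  filter_upwards [tendstoUniformlyOn_neg_minDensity hlaw hindep hb u hu] with N hN t ht
  rw [(hasDerivWithinAt_Gn hlaw hindep N ht.1).derivWithin (uniqueDiffOn_Ici 0 t ht.1)]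
  exact hN t ht

end Limit

end

end ExpArea

/-- `X 0, X 1, ...` are i.i.d. standard exponential. At the left end point `0` all derivatives
are one-sided; `0 < c k` includes that the polytope has finite volume. -/
theorem proposition2 {Ω : Type*} [MeasurableSpace Ω] (P : Measure Ω) [IsProbabilityMeasure P]
    (X : ℕ → Ω → ℝ) (hlaw : ∀ i, HasLaw (X i) (expMeasure 1) P) (hindep : iIndepFun X P) :
    (∀ k, 1 ≤ k → 0 < ExpArea.c k) ∧
    (ExpArea.c =O[atTop] fun k : ℕ => Real.sqrt k * Real.exp k) ∧
    (∀ n, 1 ≤ n → ContDiffOn ℝ 1 (ExpArea.Gn P X n) (Set.Ici 0)) ∧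
    (∀ t ∈ Set.Ico (0 : ℝ) 1,
      Summable fun k : ℕ => ExpArea.c (k + 1) * (t * Real.exp (-t)) ^ k) ∧
    (∀ ε ∈ Set.Ioo (0 : ℝ) 1,
      TendstoUniformlyOn (fun n t => derivWithin (ExpArea.Gn P X n) (Set.Ici 0) t)
        (ExpArea.rhs P X) atTop (Set.Icc 0 (1 - ε))) ∧
    ContDiffOn ℝ 1 (ExpArea.G P X) (Set.Ico 0 1) ∧
    (∀ t ∈ Set.Ico (0 : ℝ) 1,
      HasDerivWithinAt (ExpArea.G P X) (ExpArea.rhs P X t) (Set.Ico 0 1) t) := by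
  refine ⟨fun k hk => ?_, ExpArea.c_isBigO, fun n hn => ?_,
    fun t ht => ExpArea.summable_c_mul_exp ht,
    fun ε hε => ExpArea.tendstoUniformlyOn_derivWithin_Gn hlaw hindep
      ⟨(sub_pos.2 hε.2).le, sub_lt_self 1 hε.1⟩,
    ExpArea.contDiffOn_one_of_hasDerivWithinAt (uniqueDiffOn_Ico 0 1)
      (ExpArea.continuousOn_rhs hlaw hindep) fun t ht => ExpArea.hasDerivWithinAt_G hlaw hindep ht,
    fun t ht => ExpArea.hasDerivWithinAt_G hlaw hindep ht⟩
  · obtain ⟨p, rfl⟩ := Nat.exists_eq_add_of_le' hk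
    exact ExpArea.c_pos p
  · obtain ⟨N, rfl⟩ := Nat.exists_eq_add_of_le' hn
    exact ExpArea.contDiffOn_Gn hlaw hindep N
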